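/- Let $k$ be a field, $n\ge 0$, $S=k[x_1,\dots,x_n]$, and let $S_d$ be the space of forms of degree $d$. For a homogeneous ideal $I$ put $I_d=I\cap S_d$ and let $S_1I_d\subseteq S_{d+1}$ be the span of the products of a linear form and an element of $I_d$. The ideal $I$ is called Gotzmann if for every degree $d$ and every homogeneous ideal $J$ of $S$ with $\dim_k J_d=\dim_k I_d$ one has $\dim_k S_1I_d\le \dim_k S_1J_d$. A monomial ideal is squarefree if its minimal monomial generators are all squarefree. A finite simplicial complex $\Delta$ of dimension $d$ is called a supernova if it has a chain of faces $\varnothing\subset F_0\subset F_1\subset\dots\subset F_{d-1}$ with $\dim F_i=i$ such that, for every $i$, each $i$-dimensional facet of $\Delta$ contains $F_{i-1}$ (where $F_{-1}=\varnothing$). The edge ideal of a simplicial complex whose vertices are among $x_1,\dots,x_n$ is the ideal of $S$ generated by the products $\prod_{x_i\in F}x_i$ over its facets $F\neq\varnothing$; the complex without nonempty faces counts as a supernova, with edge ideal $(0)$. Theorem. Let $I\neq S$ be a squarefree monomial ideal of $S$. Then the following are equivalent: (a) $I$ is Gotzmann; (b) $$I=m_1(x_{i_{1,1}},\dots,x_{i_{1,r_1}})+m_1m_2(x_{i_{2,1}},\dots,x_{i_{2,r_2}})+\cdots+m_1\cdots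 m_s(x_{i_{s,1}},\dots,x_{i_{s,r_s}})$$ for some $s\ge 0$, $r_1,\dots,r_s\ge 1$, squarefree monomials $m_1,\dots,m_s$ (possibly equal to $1$) and variables $x_{i_{j,l}}$, all having pairwise disjoint supports (the empty sum, $s=0$, is the zero ideal); (c) $I$ is the edge ideal of a supernova whose vertices are among $x_1,\dots,x_n$. Moreover, if $I$ is Gotzmann, then $I$ has at most $n$ minimal monomial generators. -/

import Mathlib

open MvPolynomial

attribute [local instance] MvPolynomial.gradedAlgebra

/-- A monomial ideal of `k[x_1, …, x_n]`: an ideal with a generating set consisting of monomials. -/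
def IsMonomialIdeal {k : Type*} [Field k] {n : ℕ} (I : Ideal (MvPolynomial (Fin n) k)) : Prop :=
  ∃ A : Set (Fin n →₀ ℕ), I = Ideal.span ((fun a => monomial a (1 : k)) '' A)

/-- The canonical minimal set of monomial generators of a monomial ideal, as a set of exponent
vectors: the monomials of `I` that are minimal with respect to divisibility. -/
def monomialGens {k : Type*} [Field k] {n : ℕ} (I : Ideal (MvPolynomial (Fin n) k)) :
    Set (Fin n →₀ ℕ) :=
  {a | Minimal (fun b => monomial b (1 : k) ∈ I) a}

/-- A squarefree monomial ideal: a monomial ideal all of whose minimal monomial generators are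
squarefree. -/
def IsSquarefreeMonomialIdeal {k : Type*} [Field k] {n : ℕ}
    (I : Ideal (MvPolynomial (Fin n) k)) : Prop :=
  IsMonomialIdeal I ∧ ∀ a ∈ monomialGens I, ∀ i, a i ≤ 1

/-- `I_d`, the `k`-vector space of the forms of degree `d` in the ideal `I`. -/
noncomputable def idealDegree {k : Type*} [Field k] {n : ℕ} (I : Ideal (MvPolynomial (Fin n) k)) (d : ℕ) :
    Submodule k (MvPolynomial (Fin n) k) :=
  I.restrictScalars k ⊓ homogeneousSubmodule (Fin n) k d

/-- A Gotzmann ideal of `S = k[x_1, …, x_n]`: for every degree `d` and every homogeneous ideal `J`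
with `dim I_d = dim J_d` one has `dim S_1 I_d ≤ dim S_1 J_d`, where `S_1 V` is the span of the
products of a linear form and an element of `V`. -/
def IsGotzmannIdeal {k : Type*} [Field k] {n : ℕ} (I : Ideal (MvPolynomial (Fin n) k)) : Prop :=
  ∀ (d : ℕ) (J : Ideal (MvPolynomial (Fin n) k)),
    J.IsHomogeneous (homogeneousSubmodule (Fin n) k) →
    Module.finrank k (idealDegree I d) = Module.finrank k (idealDegree J d) →
    Module.finrank k ↥(homogeneousSubmodule (Fin n) k 1 * idealDegree I d) ≤
      Module.finrank k ↥(homogeneousSubmodule (Fin n) k 1 * idealDegree J d)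

/-- The squarefree monomial with support `A`. -/
noncomputable def sqfreeMonomial (k : Type*) [Field k] {n : ℕ} (A : Finset (Fin n)) :
    MvPolynomial (Fin n) k :=
  ∏ i ∈ A, X i

/-- `I = m_1 (x_{1,1}, …, x_{1,r_1}) + m_1 m_2 (x_{2,1}, …, x_{2,r_2}) + ⋯ +
m_1 ⋯ m_s (x_{s,1}, …, x_{s,r_s})` with `s ≥ 0` and all `r_j ≥ 1`, for squarefree monomials `m_j`
(given by their supports `M j`) and variables `x_{j,1}, …, x_{j,r_j}` (given by the set `Y j` of
their indices), all having pairwise disjoint supports. -/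
def HasNestedForm {k : Type*} [Field k] {n : ℕ} (I : Ideal (MvPolynomial (Fin n) k)) : Prop :=
  ∃ (s : ℕ) (M Y : Fin s → Finset (Fin n)),
    (∀ j, (Y j).Nonempty) ∧
    (∀ i j, i ≠ j → Disjoint (M i) (M j)) ∧
    (∀ i j, i ≠ j → Disjoint (Y i) (Y j)) ∧
    (∀ i j, Disjoint (M i) (Y j)) ∧
    I = ∑ j : Fin s, Ideal.span {∏ l ∈ Finset.Iic j, sqfreeMonomial k (M l)} *
      Ideal.span ((fun i => (X i : MvPolynomial (Fin n) k)) '' (Y j : Set (Fin n)))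

/-- The facets of a simplicial complex on (a subset of) the vertices `x_1, …, x_n`. The empty face
is not listed among the faces. -/
def scFacets {n : ℕ} (Δ : PreAbstractSimplicialComplex (Fin n)) : Set (Finset (Fin n)) :=
  {f | Maximal (fun g => g ∈ Δ.faces) f}

/-- The dimension of a simplicial complex, where a face with `c` vertices has dimension `c - 1`
(and the complex without nonempty faces gets the value `0`). -/
noncomputable def scDim {n : ℕ} (Δ : PreAbstractSimplicialComplex (Fin n)) : ℕ :=
  sSup ((fun f => f.card - 1) '' Δ.faces)

/-- A `d`-dimensional simplicial complex is a supernova if there is a chain of faces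
`∅ ⊂ F_0 ⊂ F_1 ⊂ ⋯ ⊂ F_{d-1}` with `dim F_i = i` such that, for all `i`, every `i`-dimensional facet
contains `F_{i-1}`. (For `0`-dimensional facets there is nothing to require; below, the facet has
dimension `i + 1`, that is, `i + 2` vertices.) -/
def IsSupernova {n : ℕ} (Δ : PreAbstractSimplicialComplex (Fin n)) : Prop :=
  ∃ F : Fin (scDim Δ) → Finset (Fin n),
    StrictMono F ∧
    (∀ i, F i ∈ Δ.faces ∧ (F i).card = (i : ℕ) + 1) ∧
    ∀ f ∈ scFacets Δ, ∀ i : Fin (scDim Δ), f.card = (i : ℕ) + 2 → F i ⊆ f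

/-- The edge ideal of a simplicial complex: the ideal generated by the squarefree monomials whose
supports are its facets. -/
noncomputable def edgeIdeal (k : Type*) [Field k] {n : ℕ} (Δ : PreAbstractSimplicialComplex (Fin n)) :
    Ideal (MvPolynomial (Fin n) k) :=
  Ideal.span (sqfreeMonomial k '' scFacets Δ)

/-!
# Squarefree Gotzmann ideals

A squarefree monomial ideal is encoded by the antichain `G` of the supports of its generators; a
monomial lies in it if and only if its support contains a member of `G`. Passing from a subspace of
`S_d` to its leading monomials does not increase the dimension of `S_1 V`, so the Gotzmann property
of such an ideal only compares sets of monomials of degree `d` by the number of their multiples in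
degree `d + 1` (`isGotzmannIdeal_span_sqfreeMonomial_iff`). The ideals of the theorem correspond to
the families that are *nested* (`IsNestedBy`): each `g ∈ G` has an element `y g` such that the sets
`g \ {y g}` increase with the cardinality of `g`. Grouping the members of `G` by `g \ {y g}` gives
the nested form, and these sets are the relevant members of the chain of faces of a supernova.

*Macaulay's theorem* (`macaulayBound`): lexicographic segments have the fewest multiples. By
induction on the number of variables, replacing the coefficients of the powers of a variable by
lexicographic segments does not increase the number of multiples. A set of monomials that is
unchanged by all these compressions has at least as many monomials avoiding the last variable as the
lexicographic segment of its size (`IsCompressed.card_layer_le`), and for lexicographic segments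
this number determines the number of multiples (`IsLexSegment.card_up`).

*Nested families are Gotzmann* (`IsNestedBy.isGotzmannFamily`). Either some variable divides all
generators or some variable is itself a generator. Compared with lexicographic segments, neither
multiplying by a variable nor adjoining a new variable destroys the Gotzmann property.

*Gotzmann families are nested* (`IsGotzmannFamily.isNested`), by induction on the number `n` of
variables. The compression argument shows that setting a variable `x` to zero preserves the Gotzmann
property (`IsGotzmannFamily.filter_notMem`), so the generators avoiding `x` are nested. A double
count then bounds the number of generators by `n` (`card_le_of_isNested_filter`). Finally, a
generator `g` preceded by `t` generators `h` contributes `n` new multiples less the number of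
variables `x` with `h \ g = {x}` for some `h`, hence at least `n - t`. As there are at most `n`
generators, some set of monomials of the same size attains this bound
(`IsNestedBy.exists_card_up_le`). So a Gotzmann family attains it as well: the sets `h \ g` are
distinct singletons, which forces the family to be nested (`HasSingletonDiffs.isNested`).
-/

/-! ### Monomials and lexicographic segments -/

section Monomials

variable {σ : Type*}

theorem exists_add_single {a : σ →₀ ℕ} {i : σ} (h : a i ≠ 0) :
    ∃ b, b + Finsupp.single i 1 = a :=
  ⟨a - Finsupp.single i 1, tsub_add_cancel_of_le
    (Finsupp.single_le_iff.2 (Nat.one_le_iff_ne_zero.2 h))⟩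

variable [LinearOrder σ]

/-- The monomials of degree `d` in the variables of `T`, as exponent vectors. -/
def mons (T : Finset σ) (d : ℕ) : Finset (σ →₀ ℕ) := T.finsuppAntidiag d

/-- The exponent vectors of the products of a variable of `T` and a monomial of `A`. -/
noncomputable def up (T : Finset σ) (A : Finset (σ →₀ ℕ)) : Finset (σ →₀ ℕ) :=
  A.biUnion fun a => T.image fun i => a + Finsupp.single i 1

theorem mem_mons {T : Finset σ} {d : ℕ} {a : σ →₀ ℕ} :
    a ∈ mons T d ↔ a.degree = d ∧ a.support ⊆ T := by
  rw [mons, Finset.mem_finsuppAntidiag']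
  rfl

theorem mem_up {T : Finset σ} {A : Finset (σ →₀ ℕ)} {b : σ →₀ ℕ} :
    b ∈ up T A ↔ ∃ a ∈ A, ∃ i ∈ T, a + Finsupp.single i 1 = b := by
  simp [up]

theorem add_single_mem_up {T : Finset σ} {A : Finset (σ →₀ ℕ)} {a : σ →₀ ℕ} (ha : a ∈ A) {i : σ}
    (hi : i ∈ T) : a + Finsupp.single i 1 ∈ up T A :=
  mem_up.2 ⟨a, ha, i, hi, rfl⟩

theorem up_mono {T : Finset σ} {A B : Finset (σ →₀ ℕ)} (h : A ⊆ B) : up T A ⊆ up T B :=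
  Finset.biUnion_subset_biUnion_of_subset_left _ h

theorem up_union (T : Finset σ) (A B : Finset (σ →₀ ℕ)) : up T (A ∪ B) = up T A ∪ up T B :=
  Finset.union_biUnion

theorem add_single_mem_mons {T : Finset σ} {d : ℕ} {a : σ →₀ ℕ} {i : σ} {j : ℕ} (ha : a ∈ mons T d)
    (hi : i ∈ T) : a + Finsupp.single i j ∈ mons T (d + j) := by
  rw [mem_mons] at ha ⊢
  refine ⟨by simp [ha.1], fun k hk => ?_⟩
  by_cases hki : k = i
  · exact hki ▸ hi
  · refine ha.2 ?_
    simpa [Finsupp.single_apply, Ne.symm hki] using hk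

theorem up_subset_mons {T : Finset σ} {d : ℕ} {A : Finset (σ →₀ ℕ)} (hA : A ⊆ mons T d) :
    up T A ⊆ mons T (d + 1) := by
  intro b hb
  obtain ⟨a, ha, i, hi, rfl⟩ := mem_up.1 hb
  exact add_single_mem_mons (hA ha) hi

theorem mons_mono {T U : Finset σ} (h : T ⊆ U) (d : ℕ) : mons T d ⊆ mons U d :=
  Finset.finsuppAntidiag_mono h d

theorem apply_le_of_mem_mons {T : Finset σ} {d : ℕ} {a : σ →₀ ℕ} (ha : a ∈ mons T d) (i : σ) :
    a i ≤ d := (mem_mons.1 ha).1 ▸ Finsupp.le_degree i a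

theorem mem_mons_of_add_single {T : Finset σ} {d : ℕ} {a : σ →₀ ℕ} {i : σ} {j : ℕ}
    (ha : a + Finsupp.single i j ∈ mons T (d + j)) : a ∈ mons T d := by
  rw [mem_mons] at ha ⊢
  refine ⟨by simpa using ha.1, fun k hk => ha.2 ?_⟩
  simp at hk ⊢
  omega

theorem up_mons {T : Finset σ} (d : ℕ) : up T (mons T d) = mons T (d + 1) := by
  refine (up_subset_mons subset_rfl).antisymm fun b hb => ?_
  have h0 : b ≠ 0 := by
    rintro rfl
    simpa using (mem_mons.1 hb).1
  obtain ⟨i, hi⟩ := Finsupp.support_nonempty_iff.2 h0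
  obtain ⟨a, rfl⟩ := exists_add_single (Finsupp.mem_support_iff.1 hi)
  exact add_single_mem_up (mem_mons_of_add_single hb) ((mem_mons.1 hb).2 hi)

/-- A lexicographic segment of degree `d` in the variables of `T`, where smaller elements of `T`
are larger as variables: a set of monomials that contains with each monomial all those which are
lexicographically larger. -/
def IsLexSegment (T : Finset σ) (d : ℕ) (L : Finset (σ →₀ ℕ)) : Prop :=
  L ⊆ mons T d ∧ ∀ a ∈ L, ∀ b ∈ mons T d, toLex a ≤ toLex b → b ∈ L

theorem IsLexSegment.total {T : Finset σ} {d : ℕ} {L M : Finset (σ →₀ ℕ)} (hL : IsLexSegment T d L)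
    (hM : IsLexSegment T d M) : L ⊆ M ∨ M ⊆ L := by
  by_contra! h
  obtain ⟨⟨a, ha, ha'⟩, b, hb, hb'⟩ := h.imp Finset.not_subset.1 Finset.not_subset.1
  rcases le_total (toLex a) (toLex b) with h | h
  · exact hb' (hL.2 a ha b (hM.1 hb) h)
  · exact ha' (hM.2 b hb a (hL.1 ha) h)

theorem IsLexSegment.subset_of_card_le {T : Finset σ} {d : ℕ} {L M : Finset (σ →₀ ℕ)}
    (hL : IsLexSegment T d L) (hM : IsLexSegment T d M) (h : L.card ≤ M.card) : L ⊆ M := by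
  rcases hL.total hM with h' | h'
  · exact h'
  · exact (Finset.eq_of_subset_of_card_le h' h).ge

theorem exists_isLexSegment (T : Finset σ) (d : ℕ) {p : ℕ} (hp : p ≤ (mons T d).card) :
    ∃ L, IsLexSegment T d L ∧ L.card = p := by
  induction p with
  | zero => exact ⟨∅, ⟨by simp, by simp⟩, rfl⟩
  | succ p ih =>
    obtain ⟨L, hL, hLp⟩ := ih (by omega)
    have hne : (mons T d \ L).Nonempty := by
      rw [← Finset.card_pos, Finset.card_sdiff_of_subset hL.1]
      omega
    obtain ⟨m, hm, hmax⟩ := Finset.exists_max_image _ (fun a => toLex a) hne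
    rw [Finset.mem_sdiff] at hm
    refine ⟨insert m L, ⟨Finset.insert_subset hm.1 hL.1, fun a ha b hb hab => ?_⟩, ?_⟩
    · by_cases hbL : b ∈ L
      · exact Finset.mem_insert_of_mem hbL
      rcases Finset.mem_insert.1 ha with rfl | ha
      · have := hmax b (Finset.mem_sdiff.2 ⟨hb, hbL⟩)
        exact Finset.mem_insert.2 (Or.inl (toLex.injective (this.antisymm hab)))
      · exact absurd (hL.2 a ha b hb hab) hbL
    · rw [Finset.card_insert_of_notMem hm.2, hLp]

theorem toLex_le_add (a b : σ →₀ ℕ) : toLex a ≤ toLex (a + b) :=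
  Finsupp.toLex_monotone (le_self_add)

/-- Of two distinct monomials of the same degree, the lexicographically smaller one has the larger
exponent at some variable beyond the first difference. -/
theorem exists_lt_of_lex_lt {T : Finset σ} {d : ℕ} {a b : σ →₀ ℕ} (ha : a ∈ mons T d)
    (hb : b ∈ mons T d) (h : toLex a < toLex b) :
    ∃ t s, t < s ∧ (∀ r < t, a r = b r) ∧ a t < b t ∧ b s < a s := by
  obtain ⟨t, ht, hlt⟩ := Finsupp.Lex.lt_iff.1 h
  have ht' : ∀ r < t, a r = b r := ht
  have hlt' : a t < b t := hlt
  by_contra! hcon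
  have hle : a ≤ b := fun s => by
    rcases lt_trichotomy s t with hs | rfl | hs
    · exact (ht' s hs).le
    · exact hlt'.le
    · exact hcon t s hs ht' hlt'
  have hab : a = b := by
    obtain ⟨c, rfl⟩ := exists_add_of_le hle
    have h1 := (mem_mons.1 ha).1
    have h2 := (mem_mons.1 hb).1
    rw [map_add, h1] at h2
    have : c.degree = 0 := by omega
    rw [Finsupp.degree_eq_zero_iff] at this
    simp [this]
  subst hab
  exact lt_irrefl _ hlt'

theorem IsLexSegment.up {T : Finset σ} {d : ℕ} {L : Finset (σ →₀ ℕ)} (hL : IsLexSegment T d L) :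
    IsLexSegment T (d + 1) (up T L) := by
  refine ⟨up_subset_mons hL.1, fun c hc b hb hcb => ?_⟩
  obtain ⟨a, ha, i, hi, rfl⟩ := mem_up.1 hc
  have h0 : b ≠ 0 := by
    rintro rfl
    simpa using (mem_mons.1 hb).1
  have hne := Finsupp.support_nonempty_iff.2 h0
  -- dividing `b` by its smallest variable gives a monomial that is not smaller than `a`
  set j := b.support.max' hne with hj
  have hjb : j ∈ b.support := Finset.max'_mem _ _
  obtain ⟨b', hb'⟩ := exists_add_single (Finsupp.mem_support_iff.1 hjb)
  have hb'm : b' ∈ mons T d := mem_mons_of_add_single (hb' ▸ hb)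
  have hjT := (mem_mons.1 hb).2 hjb
  rw [← hb']
  refine add_single_mem_up (hL.2 a ha b' hb'm (not_lt.1 fun hlt => ?_)) hjT
  obtain ⟨t, s, hts, heq, htlt, hs⟩ := exists_lt_of_lex_lt hb'm (hL.1 ha) hlt
  have hsj : s ≤ j := by
    refine Finset.le_max' _ _ ?_
    rw [Finsupp.mem_support_iff, ← hb', Finsupp.add_apply]
    omega
  have hbb : ∀ r < j, b r = b' r := fun r hr => by
    rw [← hb', Finsupp.add_apply, Finsupp.single_eq_of_ne (by exact hr.ne), add_zero]
  have : toLex b < toLex a := by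
    refine Finsupp.Lex.lt_iff.2 ⟨t, fun r hr => ?_, ?_⟩
    · exact (hbb r (hr.trans (hts.trans_le hsj))).trans (heq r hr)
    · exact ((hbb t (hts.trans_le hsj)).trans_lt htlt :)
  exact absurd hcb (not_le.2 (this.trans_le (toLex_le_add _ _)))

end Monomials

/-! ### Macaulay's theorem -/

section Macaulay

variable {σ : Type*} [LinearOrder σ]

/-- The coefficient of `x ^ j` of a set of monomials: the monomials not involving `x` whose product
with `x ^ j` belongs to the set. -/
noncomputable def layer (x : σ) (j : ℕ) (A : Finset (σ →₀ ℕ)) : Finset (σ →₀ ℕ) :=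
  (A.filter fun a => a x = j).image (Finsupp.erase x)

theorem mem_layer {x : σ} {j : ℕ} {A : Finset (σ →₀ ℕ)} {a : σ →₀ ℕ} :
    a ∈ layer x j A ↔ a x = 0 ∧ a + Finsupp.single x j ∈ A := by
  simp only [layer, Finset.mem_image, Finset.mem_filter]
  constructor
  · rintro ⟨b, ⟨hb, rfl⟩, rfl⟩
    exact ⟨Finsupp.erase_same, by rwa [Finsupp.erase_add_single]⟩
  · rintro ⟨h0, h⟩
    refine ⟨_, ⟨h, by simp [h0]⟩, ?_⟩
    rw [Finsupp.erase_add, Finsupp.erase_single, add_zero, Finsupp.erase_of_notMem_support]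
    simpa using h0

theorem card_layer (x : σ) (j : ℕ) (A : Finset (σ →₀ ℕ)) :
    (layer x j A).card = (A.filter fun a => a x = j).card := by
  refine Finset.card_image_of_injOn fun a ha b hb hab => ?_
  simp only [Finset.coe_filter, Set.mem_ofPred_eq] at ha hb
  rw [← Finsupp.erase_add_single x a, ← Finsupp.erase_add_single x b, ha.2, hb.2]
  exact congrArg (· + Finsupp.single x j) hab

theorem sum_card_layer (x : σ) {N : ℕ} {A : Finset (σ →₀ ℕ)} (hA : ∀ a ∈ A, a x < N) :
    ∑ j ∈ Finset.range N, (layer x j A).card = A.card := by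
  rw [Finset.card_eq_sum_card_fiberwise (f := fun a => a x) (t := Finset.range N)
    (fun a ha => by simpa using hA a ha)]
  exact Finset.sum_congr rfl fun j _ => card_layer x j A

theorem layer_subset_mons {T : Finset σ} {d j : ℕ} (x : σ) (hj : j ≤ d) {A : Finset (σ →₀ ℕ)}
    (hA : A ⊆ mons T d) : layer x j A ⊆ mons (T.erase x) (d - j) := by
  intro a ha
  obtain ⟨h0, h⟩ := mem_layer.1 ha
  have h1 : a ∈ mons T (d - j) := by
    refine mem_mons_of_add_single (i := x) (j := j) ?_
    rw [Nat.sub_add_cancel hj]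
    exact hA h
  rw [mem_mons] at h1 ⊢
  refine ⟨h1.1, fun k hk => Finset.mem_erase.2 ⟨?_, h1.2 hk⟩⟩
  rintro rfl
  simp [h0] at hk

theorem layer_zero_up {T : Finset σ} {x : σ} (A : Finset (σ →₀ ℕ)) :
    layer x 0 (up T A) = up (T.erase x) (layer x 0 A) := by
  ext b
  simp only [mem_layer, mem_up, Finsupp.single_zero, add_zero, Finset.mem_erase]
  constructor
  · rintro ⟨h0, a, ha, i, hi, rfl⟩
    rw [Finsupp.add_apply, Nat.add_eq_zero_iff] at h0
    refine ⟨a, ⟨h0.1, ha⟩, i, ⟨?_, hi⟩, rfl⟩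
    rintro rfl
    simp at h0
  · rintro ⟨a, ⟨h0, ha⟩, i, ⟨hix, hi⟩, rfl⟩
    exact ⟨by simp [h0, Finsupp.single_eq_of_ne' hix], a, ha, i, hi, rfl⟩

theorem layer_succ_up {T : Finset σ} {x : σ} (hx : x ∈ T) (j : ℕ) (A : Finset (σ →₀ ℕ)) :
    layer x (j + 1) (up T A) = up (T.erase x) (layer x (j + 1) A) ∪ layer x j A := by
  ext b
  simp only [mem_layer, mem_up, Finset.mem_erase, Finset.mem_union]
  constructor
  · rintro ⟨h0, a, ha, i, hi, h⟩
    by_cases hix : i = x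
    · subst hix
      right
      refine ⟨h0, ?_⟩
      rw [Finsupp.single_add, ← add_assoc, add_left_inj] at h
      rwa [← h]
    · left
      have hbi : b i ≠ 0 := by
        have := DFunLike.congr_fun h i
        simp [Finsupp.single_eq_of_ne hix] at this
        omega
      obtain ⟨c, rfl⟩ := exists_add_single hbi
      refine ⟨c, ⟨by simp at h0; exact h0.1, ?_⟩, i, ⟨hix, hi⟩, rfl⟩
      rw [add_right_comm, add_left_inj] at h
      rwa [← h]
  · rintro (⟨a, ⟨h0, ha⟩, i, ⟨hix, hi⟩, rfl⟩ | ⟨h0, ha⟩)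
    · exact ⟨by simp [h0, Finsupp.single_eq_of_ne' hix], _, ha, i, hi, add_right_comm _ _ _⟩
    · exact ⟨h0, _, ha, x, hx, by rw [Finsupp.single_add, add_assoc]⟩

/-- The number of multiples of a set of monomials, counted by the exponent of `x`. -/
theorem card_up_eq_sum {T : Finset σ} {d : ℕ} {x : σ} (hx : x ∈ T) {A : Finset (σ →₀ ℕ)}
    (hA : A ⊆ mons T d) :
    (up T A).card = (up (T.erase x) (layer x 0 A)).card +
      ∑ j ∈ Finset.range (d + 1), (up (T.erase x) (layer x (j + 1) A) ∪ layer x j A).card := by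
  rw [← sum_card_layer x (N := d + 2)
    (fun a ha => Nat.lt_succ_of_le (apply_le_of_mem_mons (up_subset_mons hA ha) x)),
    Finset.sum_range_succ', add_comm, layer_zero_up]
  simp_rw [layer_succ_up hx]

theorem card_eq_sum_layer {T : Finset σ} {d : ℕ} (x : σ) {A : Finset (σ →₀ ℕ)}
    (hA : A ⊆ mons T d) : ∑ j ∈ Finset.range (d + 1), (layer x j A).card = A.card :=
  sum_card_layer x fun _ ha => Nat.lt_succ_of_le (apply_le_of_mem_mons (hA ha) x)

theorem card_add_card_up_layer_le {T : Finset σ} {d : ℕ} {x : σ} (hx : x ∈ T)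
    {A : Finset (σ →₀ ℕ)} (hA : A ⊆ mons T d) :
    (up (T.erase x) (layer x 0 A)).card + A.card ≤ (up T A).card := by
  rw [card_up_eq_sum hx hA, ← card_eq_sum_layer x hA]
  gcongr
  exact Finset.subset_union_right

theorem IsLexSegment.layer {T : Finset σ} {d j : ℕ} {x : σ} (hx : x ∈ T) (hj : j ≤ d)
    {L : Finset (σ →₀ ℕ)} (hL : IsLexSegment T d L) :
    IsLexSegment (T.erase x) (d - j) (layer x j L) := by
  refine ⟨layer_subset_mons x hj hL.1, fun a ha b hb hab => ?_⟩
  obtain ⟨_, ha⟩ := mem_layer.1 ha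
  refine mem_layer.2 ⟨?_, hL.2 _ ha _ ?_ (add_le_add_left hab (toLex (Finsupp.single x j)))⟩
  · by_contra h
    simpa using (mem_mons.1 hb).2 (Finsupp.mem_support_iff.2 h)
  · have := add_single_mem_mons (j := j) (mons_mono (Finset.erase_subset x T) _ hb) hx
    rwa [Nat.sub_add_cancel hj] at this

/-- For a lexicographic segment, the multiples are counted by its monomials not divisible by the
smallest variable. -/
theorem IsLexSegment.card_up {T : Finset σ} {d : ℕ} {x : σ} (hx : x ∈ T) (hmax : ∀ y ∈ T, y ≤ x)
    {L : Finset (σ →₀ ℕ)} (hL : IsLexSegment T d L) :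
    (_root_.up T L).card = (_root_.up (T.erase x) (_root_.layer x 0 L)).card + L.card := by
  rw [card_up_eq_sum hx hL.1, ← card_eq_sum_layer x hL.1]
  congr 1
  refine Finset.sum_congr rfl fun j _ => congrArg _ (Finset.union_eq_right.2 fun b hb => ?_)
  obtain ⟨a, ha, i, hi, rfl⟩ := mem_up.1 hb
  obtain ⟨hix, hi⟩ := Finset.mem_erase.1 hi
  obtain ⟨h0, ha⟩ := mem_layer.1 ha
  rw [mem_layer]
  refine ⟨by simp [h0, Finsupp.single_eq_of_ne' hix], hL.2 _ ha _ ?_ ?_⟩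
  · have h1 := hL.1 ha
    rw [Finsupp.single_add, ← add_assoc] at h1
    rw [mem_mons] at h1 ⊢
    refine ⟨by simpa [add_assoc, add_comm, add_left_comm] using h1.1, fun k hk => ?_⟩
    by_cases hki : k = i
    · exact hki ▸ hi
    · refine h1.2 ?_
      simp [Finsupp.single_apply, Ne.symm hki] at hk ⊢
      tauto
  · rw [Finsupp.single_add, ← add_assoc, add_right_comm, toLex_add, toLex_add (a + _)]
    exact add_le_add_left
      (add_le_add_right (Finsupp.Lex.single_le_iff.2 (hmax i hi)) (toLex a)) _

/-- Macaulay's bound for the variables of `T`: among the sets of monomials of a given degree and a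
given cardinality, lexicographic segments have the fewest multiples. -/
def MacaulayBound (T : Finset σ) : Prop :=
  ∀ ⦃d : ℕ⦄ ⦃A L : Finset (σ →₀ ℕ)⦄, A ⊆ mons T d → IsLexSegment T d L → L.card ≤ A.card →
    (up T L).card ≤ (up T A).card

/-- Replacing each layer with respect to `x` of a set of monomials by a lexicographic segment. -/
theorem exists_compression {T : Finset σ} {x : σ} (hx : x ∈ T) (d : ℕ) (A : Finset (σ →₀ ℕ))
    (hA : A ⊆ mons T d) : ∃ C ⊆ mons T d, ∀ j ≤ d,
      IsLexSegment (T.erase x) (d - j) (layer x j C) ∧ (layer x j C).card = (layer x j A).card := by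
  have h : ∀ j, ∃ L, j ≤ d → IsLexSegment (T.erase x) (d - j) L ∧
      L.card = (layer x j A).card := fun j => by
    by_cases hj : j ≤ d
    · obtain ⟨L, hL⟩ := exists_isLexSegment (T.erase x) (d - j)
        (Finset.card_le_card (layer_subset_mons x hj hA))
      exact ⟨L, fun _ => hL⟩
    · exact ⟨∅, fun h => absurd h hj⟩
  choose L hL using h
  have hmem : ∀ j ≤ d, ∀ a ∈ L j, a x = 0 ∧ a + Finsupp.single x j ∈ mons T d := by
    intro j hj a ha
    have h1 := (hL j hj).1.1 ha
    refine ⟨?_, ?_⟩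
    · by_contra h
      simpa using (mem_mons.1 h1).2 (Finsupp.mem_support_iff.2 h)
    · have := add_single_mem_mons (j := j) (mons_mono (Finset.erase_subset x T) _ h1) hx
      rwa [Nat.sub_add_cancel hj] at this
  refine ⟨(Finset.range (d + 1)).biUnion fun j => (L j).image (· + Finsupp.single x j), ?_, ?_⟩
  · intro a ha
    simp only [Finset.mem_biUnion, Finset.mem_range, Finset.mem_image] at ha
    obtain ⟨j, hj, b, hb, rfl⟩ := ha
    exact (hmem j (by omega) b hb).2
  · intro j hj
    suffices h : layer x j ((Finset.range (d + 1)).biUnion fun j =>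
        (L j).image (· + Finsupp.single x j)) = L j from h ▸ hL j hj
    ext a
    simp only [mem_layer, Finset.mem_biUnion, Finset.mem_range, Finset.mem_image]
    constructor
    · rintro ⟨h0, i, hi, b, hb, h⟩
      have hij : i = j := by
        have := DFunLike.congr_fun h x
        simpa [h0, (hmem i (by omega) b hb).1] using this
      subst hij
      rw [add_left_inj] at h
      rwa [← h]
    · intro ha
      exact ⟨(hmem j hj a ha).1, j, by omega, a, ha, rfl⟩

theorem layer_eq_empty {T : Finset σ} {d j : ℕ} (x : σ) (hj : d < j) {A : Finset (σ →₀ ℕ)}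
    (hA : A ⊆ mons T d) : layer x j A = ∅ := by
  refine Finset.eq_empty_of_forall_notMem fun a ha => ?_
  have := apply_le_of_mem_mons (hA (mem_layer.1 ha).2) x
  simp at this
  omega

/-- Compression does not increase the number of multiples, and the difference is at least the
difference in the layer with exponent `0`. -/
theorem MacaulayBound.compression {T : Finset σ} {x : σ} (hx : x ∈ T)
    (hT : MacaulayBound (T.erase x)) {d : ℕ} {A C : Finset (σ →₀ ℕ)} (hA : A ⊆ mons T d)
    (hC : C ⊆ mons T d)
    (hCA : ∀ j ≤ d,
      IsLexSegment (T.erase x) (d - j) (layer x j C) ∧ (layer x j C).card = (layer x j A).card) :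
    (up T C).card + (up (T.erase x) (layer x 0 A)).card ≤
      (up T A).card + (up (T.erase x) (layer x 0 C)).card := by
  rw [card_up_eq_sum hx hA, card_up_eq_sum hx hC, add_comm, ← add_assoc,
    add_right_comm _ _ (Finset.card (up _ (layer x 0 C)))]
  refine add_le_add_right (Finset.sum_le_sum fun j hj => ?_) _
  have hj : j ≤ d := Nat.lt_succ_iff.1 (Finset.mem_range.1 hj)
  rcases hj.eq_or_lt with rfl | hjd
  · simp [layer_eq_empty x (Nat.lt_succ_self j) hA, layer_eq_empty x (Nat.lt_succ_self j) hC, up,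
      (hCA j le_rfl).2]
  · have h1 := hCA (j + 1) hjd
    -- both sets in the union are lexicographic segments of the same degree, hence comparable
    have h2 := h1.1.up
    rw [show d - (j + 1) + 1 = d - j by omega] at h2
    rcases h2.total (hCA j hj).1 with h | h
    · rw [Finset.union_eq_right.2 h, (hCA j hj).2]
      exact Finset.card_le_card Finset.subset_union_right
    · rw [Finset.union_eq_left.2 h]
      exact (hT (layer_subset_mons x hjd hA) h1.1 h1.2.le).trans
        (Finset.card_le_card Finset.subset_union_left)

theorem MacaulayBound.card_up_compression_le {T : Finset σ} {x : σ} (hx : x ∈ T)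
    (hT : MacaulayBound (T.erase x)) {d : ℕ} {A C : Finset (σ →₀ ℕ)} (hA : A ⊆ mons T d)
    (hC : C ⊆ mons T d)
    (hCA : ∀ j ≤ d,
      IsLexSegment (T.erase x) (d - j) (layer x j C) ∧ (layer x j C).card = (layer x j A).card) :
    (up T C).card ≤ (up T A).card := by
  have h1 := hT.compression hx hA hC hCA
  have h2 := hT (layer_subset_mons x (Nat.zero_le d) hA) (hCA 0 (Nat.zero_le d)).1
    (hCA 0 (Nat.zero_le d)).2.le
  omega

/-- The sets of monomials all of whose layers with respect to `x` are lexicographic segments. -/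
def IsCompressed (T : Finset σ) (d : ℕ) (x : σ) (A : Finset (σ →₀ ℕ)) : Prop :=
  ∀ j ≤ d, IsLexSegment (T.erase x) (d - j) (layer x j A)

/-- Every set of monomials can be replaced by one of the same cardinality, with no more multiples,
which is compressed with respect to all variables. -/
theorem exists_isCompressed {T : Finset σ} (hT : ∀ x ∈ T, MacaulayBound (T.erase x)) {d : ℕ}
    {A : Finset (σ →₀ ℕ)} (hA : A ⊆ mons T d) :
    ∃ B ⊆ mons T d, B.card = A.card ∧ (up T B).card ≤ (up T A).card ∧
      ∀ x ∈ T, IsCompressed T d x B := by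
  classical
  -- a set which is maximal for the colexicographic order of sets is its own compression
  obtain ⟨B, hB, hmax⟩ := Finset.exists_max_image
    ((mons T d).powerset.filter fun B => B.card = A.card ∧ (up T B).card ≤ (up T A).card)
    (fun B => toColex (B.image toLex)) ⟨A, by simp [hA]⟩
  simp only [Finset.mem_filter, Finset.mem_powerset] at hB hmax
  refine ⟨B, hB.1, hB.2.1, hB.2.2, fun x hx => ?_⟩
  obtain ⟨C, hC, hCB⟩ := exists_compression hx d B hB.1
  have hcard : C.card = B.card := by
    rw [← card_eq_sum_layer x hC, ← card_eq_sum_layer x hB.1]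
    exact Finset.sum_congr rfl fun j hj => (hCB j (Nat.lt_succ_iff.1 (Finset.mem_range.1 hj))).2
  have h1 := hmax C ⟨hC, hcard.trans hB.2.1,
    ((hT x hx).card_up_compression_le hx hB.1 hC hCB).trans hB.2.2⟩
  have h2 : toColex (B.image toLex) ≤ toColex (C.image toLex) := by
    rw [Finset.Colex.toColex_le_toColex]
    simp only [Finset.mem_image, forall_exists_index, and_imp, forall_apply_eq_imp_iff₂,
      EmbeddingLike.apply_eq_iff_eq, exists_eq_right, exists_exists_and_eq_and]
    intro a ha haC
    have haj := apply_le_of_mem_mons (hB.1 ha) x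
    obtain ⟨hL, hLc⟩ := hCB (a x) haj
    have ha' : a.erase x ∈ layer x (a x) B :=
      mem_layer.2 ⟨Finsupp.erase_same, by rwa [Finsupp.erase_add_single]⟩
    have ha'C : a.erase x ∉ layer x (a x) C := fun h => haC (by
      have := (mem_layer.1 h).2
      rwa [Finsupp.erase_add_single] at this)
    have hnot : ¬ layer x (a x) C ⊆ layer x (a x) B := fun h =>
      ha'C (Finset.eq_of_subset_of_card_le h hLc.ge ▸ ha')
    obtain ⟨b, hb, hbB⟩ := Finset.not_subset.1 hnot
    refine ⟨b + Finsupp.single x (a x), (mem_layer.1 hb).2,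
      fun h => hbB (mem_layer.2 ⟨(mem_layer.1 hb).1, h⟩), ?_⟩
    have hab : toLex (a.erase x) ≤ toLex b := by
      by_contra! h
      exact ha'C (hL.2 b hb _ (layer_subset_mons x haj hB.1 ha') h.le)
    have := add_le_add_left hab (toLex (Finsupp.single x (a x)))
    rwa [← toLex_add, ← toLex_add, Finsupp.erase_add_single] at this
  have h3 : C = B := Finset.image_injective toLex.injective (toColex.injective (h1.antisymm h2))
  exact fun j hj => h3 ▸ (hCB j hj).1

/-- Macaulay's bound holds for `T` as soon as every set of monomials can be improved to one that
has, not involving the last variable, as many monomials as the lexicographic segment. -/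
theorem MacaulayBound.of_card_layer {T : Finset σ} {x : σ} (hx : x ∈ T) (hmax : ∀ y ∈ T, y ≤ x)
    (hT : MacaulayBound (T.erase x))
    (h : ∀ ⦃d : ℕ⦄ ⦃A L : Finset (σ →₀ ℕ)⦄, A ⊆ mons T d → IsLexSegment T d L → L.card ≤ A.card →
      ∃ B ⊆ mons T d, B.card = A.card ∧ (up T B).card ≤ (up T A).card ∧
        (layer x 0 L).card ≤ (layer x 0 B).card) : MacaulayBound T := by
  intro d A L hA hL hLA
  obtain ⟨B, hB, hBA, hup, hlayer⟩ := h hA hL hLA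
  have h1 := card_add_card_up_layer_le hx hB
  have h2 := hL.card_up hx hmax
  have h3 := hT (layer_subset_mons x (Nat.zero_le d) hB) (hL.layer hx (Nat.zero_le d)) hlayer
  omega

theorem card_le_card_up {T : Finset σ} {x : σ} (hx : x ∈ T) (A : Finset (σ →₀ ℕ)) :
    A.card ≤ (up T A).card := by
  refine Finset.card_le_card_of_injOn (· + Finsupp.single x 1)
    (fun a ha => add_single_mem_up ha hx) fun a _ b _ h => add_left_injective _ h

theorem macaulayBound_of_card_le_one {T : Finset σ} (hT : T.card ≤ 1) : MacaulayBound T := by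
  intro d A L hA hL hLA
  have h1 : (up T L).card ≤ L.card * T.card :=
    Finset.card_biUnion_le_card_mul _ _ _ fun a _ => Finset.card_image_le
  rcases T.eq_empty_or_nonempty with rfl | ⟨x, hx⟩
  · simp at h1
    simp [h1]
  · have := card_le_card_up hx A
    nlinarith

theorem macaulayBound_of_card_eq_two {T : Finset σ} (hT : T.card = 2) : MacaulayBound T := by
  intro d A L hA hL hLA
  obtain ⟨y, x, hyx, rfl⟩ : ∃ y x, y < x ∧ T = {y, x} := by
    obtain ⟨a, b, hab, rfl⟩ := Finset.card_eq_two.1 hT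
    rcases hab.lt_or_gt with h | h
    · exact ⟨a, b, h, rfl⟩
    · exact ⟨b, a, h, Finset.pair_comm a b⟩
  rcases L.eq_empty_or_nonempty with rfl | hne
  · simp [up]
  have hAne : A.Nonempty := Finset.card_pos.1 ((Finset.card_pos.2 hne).trans_le hLA)
  have h1 : (up {y, x} L).card ≤ L.card + 1 := by
    have hmax : ∀ z ∈ ({y, x} : Finset σ), z ≤ x := by simp [hyx.le]
    rw [hL.card_up (by simp) hmax, add_comm]
    have hT' : ({y, x} : Finset σ).erase x = {y} := by
      ext z
      simp only [Finset.mem_erase, Finset.mem_insert, Finset.mem_singleton]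
      constructor
      · tauto
      · rintro rfl
        exact ⟨hyx.ne, Or.inl rfl⟩
    gcongr
    rw [hT']
    refine (Finset.card_biUnion_le_card_mul _ _ _ fun a _ => Finset.card_image_le).trans ?_
    rw [Finset.card_singleton, mul_one, Finset.card_le_one]
    intro a ha b hb
    have h2 := layer_subset_mons x (Nat.zero_le d) hL.1 ha
    have h3 := layer_subset_mons x (Nat.zero_le d) hL.1 hb
    rw [hT', mem_mons, Finsupp.support_subset_singleton] at h2 h3
    rw [h2.2, h3.2]
    have h4 := h2.1.trans h3.1.symm
    rw [h2.2, h3.2, Finsupp.degree_single, Finsupp.degree_single] at h4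
    rw [h4]
  have h2 : A.card + 1 ≤ (up {y, x} A).card := by
    obtain ⟨a, ha, hmin⟩ := Finset.exists_min_image A (fun a => a y) hAne
    have hnot : a + Finsupp.single x 1 ∉ A.image (· + Finsupp.single y 1) := by
      rw [Finset.mem_image]
      rintro ⟨b, hb, h⟩
      have h3 := DFunLike.congr_fun h y
      have := hmin b hb
      simp [Finsupp.single_eq_of_ne hyx.ne] at h3
      omega
    rw [← Finset.card_image_of_injective A (add_left_injective (Finsupp.single y 1)),
      ← Finset.card_insert_of_notMem hnot]
    refine Finset.card_le_card (Finset.insert_subset (add_single_mem_up ha (by simp)) ?_)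
    intro b hb
    obtain ⟨c, hc, rfl⟩ := Finset.mem_image.1 hb
    exact add_single_mem_up hc (by simp)
  omega

/-- Let `x` be the last variable and `y` the last one but `x`. A set of monomials that is compressed
with respect to a variable `z ≠ x, y` and with respect to `x` has at least as many monomials not
divisible by `x` as the lexicographic segments of at most the same cardinality: replacing all `x`
by `y` does not lead out of it. -/
theorem IsCompressed.card_layer_le {T : Finset σ} {x y z : σ} (hx : x ∈ T)
    (hxmax : ∀ i ∈ T, i ≤ x) (hy : y ∈ T.erase x) (hymax : ∀ i ∈ T.erase x, i ≤ y)
    (hzx : z ≠ x) (hzy : z ≠ y) {d : ℕ} {A L : Finset (σ →₀ ℕ)} (hA : A ⊆ mons T d)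
    (hAx : IsCompressed T d x A) (hAz : IsCompressed T d z A) (hL : IsLexSegment T d L)
    (hLA : L.card ≤ A.card) : (layer x 0 L).card ≤ (layer x 0 A).card := by
  by_contra! hlt
  obtain ⟨hyx, hyT⟩ := Finset.mem_erase.1 hy
  have hA0 := hAx 0 (Nat.zero_le d)
  have hL0 := hL.layer hx (Nat.zero_le d)
  obtain ⟨v, hvL, hvA⟩ := Finset.not_subset.1 fun h => hlt.not_ge (Finset.card_le_card h)
  have hvm := hL0.1 hvL
  have hvL' : v ∈ L := by simpa using (mem_layer.1 hvL).2
  have hvA' : v ∉ A := fun h => hvA (mem_layer.2 ⟨(mem_layer.1 hvL).1, by simpa using h⟩)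
  have hsub : A ⊆ L.erase v := by
    intro w hw
    -- `w'` is obtained from `w` by replacing all `x` by `y`
    set w' := w.erase x + Finsupp.single y (w x) with hw'
    have hw'm : w' ∈ mons (T.erase x) d := by
      have := hA hw
      rw [← Finsupp.erase_add_single x w, mem_mons] at this
      rw [mem_mons]
      refine ⟨by simpa [hw'] using this.1, fun k hk => ?_⟩
      by_cases hky : k = y
      · exact hky ▸ hy
      · rw [Finsupp.mem_support_iff, hw', Finsupp.add_apply, Finsupp.single_eq_of_ne hky,
          add_zero] at hk
        have hkx : k ≠ x := by
          rintro rfl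
          simp at hk
        rw [Finsupp.erase_ne hkx] at hk
        exact Finset.mem_erase.2 ⟨hkx, (mem_mons.1 (hA hw)).2 (Finsupp.mem_support_iff.2 hk)⟩
    have hle : toLex w ≤ toLex w' := by
      rcases eq_or_ne (w x) 0 with h0 | h0
      · rw [hw', h0, Finsupp.single_zero, add_zero,
          Finsupp.erase_of_notMem_support (by simpa using h0)]
      · refine le_of_lt (Finsupp.Lex.lt_iff.2 ⟨y, fun r hr => ?_, ?_⟩)
        · have hrx : r ≠ x := (hr.trans_le (hxmax y hyT)).ne
          simp [hw', Finsupp.single_eq_of_ne hr.ne, Finsupp.erase_ne hrx]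
        · simp [hw', Finsupp.erase_ne hyx]
          omega
    have hzw : w' z = w z := by
      simp [hw', Finsupp.erase_ne hzx, Finsupp.single_eq_of_ne hzy]
    have hw'A : w' ∈ A := by
      have h1 := hAz (w z) (apply_le_of_mem_mons (hA hw) z)
      have h2 : w.erase z ∈ layer z (w z) A :=
        mem_layer.2 ⟨Finsupp.erase_same, by rwa [Finsupp.erase_add_single]⟩
      have h3 : w'.erase z ∈ mons (T.erase z) (d - w z) := by
        have : w'.erase z ∈ layer z (w z) (mons T d) := mem_layer.2 ⟨Finsupp.erase_same, by
          rw [← hzw, Finsupp.erase_add_single]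
          exact mons_mono (Finset.erase_subset _ _) _ hw'm⟩
        exact layer_subset_mons z (apply_le_of_mem_mons (hA hw) z) subset_rfl this
      have h4 : toLex (w.erase z) ≤ toLex (w'.erase z) := by
        refine le_of_add_le_add_right (a := toLex (Finsupp.single z (w z))) ?_
        rw [← toLex_add, ← toLex_add, Finsupp.erase_add_single]
        rwa [← hzw, Finsupp.erase_add_single]
      have := (mem_layer.1 (h1.2 _ h2 _ h3 h4)).2
      rwa [← hzw, Finsupp.erase_add_single] at this
    have hw'x : w' x = 0 := by
      by_contra h
      simpa using (mem_mons.1 hw'm).2 (Finsupp.mem_support_iff.2 h)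
    have hvw' : toLex v < toLex w' := by
      by_contra! h
      exact hvA (hA0.2 w' (mem_layer.2 ⟨hw'x, by simpa using hw'A⟩) v hvm h)
    -- the first difference of `v` and `w'` cannot be at `y`, since their degrees agree
    have hvw : toLex v < toLex w := by
      obtain ⟨t, s, hts, heq, htlt, hs⟩ := exists_lt_of_lex_lt (by simpa using hvm) hw'm hvw'
      have hty : t < y := hts.trans_le (hymax s (by
        refine (mem_mons.1 hvm).2 (Finsupp.mem_support_iff.2 ?_)
        omega))
      have hww : ∀ r < y, w' r = w r := fun r hr => by
        simp [hw', Finsupp.single_eq_of_ne hr.ne,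
          Finsupp.erase_ne (hr.trans_le (hxmax y hyT)).ne]
      refine Finsupp.Lex.lt_iff.2 ⟨t, fun r hr => ?_, ?_⟩
      · exact (heq r hr).trans (hww r (hr.trans hty))
      · exact (htlt.trans_eq (hww t hty) :)
    refine Finset.mem_erase.2 ⟨?_, hL.2 v hvL' w (hA hw) hvw.le⟩
    rintro rfl
    exact hvA' hw
  have := Finset.card_le_card hsub
  rw [Finset.card_erase_of_mem hvL'] at this
  have := Finset.card_pos.2 ⟨v, hvL'⟩
  omega

/-- Macaulay's theorem. With at least three variables, compression with respect to the first and the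
last variable suffices. -/
theorem macaulayBound (T : Finset σ) : MacaulayBound T := by
  induction hn : T.card using Nat.strong_induction_on generalizing T with
  | _ n ih =>
  have ih' : ∀ x ∈ T, MacaulayBound (T.erase x) := fun x hx =>
    ih _ (hn ▸ Finset.card_erase_lt_of_mem hx) _ rfl
  rcases Nat.lt_or_ge T.card 3 with h3 | h3
  · rcases Nat.lt_or_ge T.card 2 with h2 | h2
    · exact macaulayBound_of_card_le_one (by omega)
    · exact macaulayBound_of_card_eq_two (by omega)
  have hne : T.Nonempty := Finset.card_pos.1 (by omega)
  obtain ⟨x, hx, hxmax⟩ := Finset.exists_max_image T id hne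
  have hx' := Finset.card_erase_of_mem hx
  obtain ⟨y, hy, hymax⟩ := Finset.exists_max_image (T.erase x) id (Finset.card_pos.1 (by omega))
  have hy' := Finset.card_erase_of_mem hy
  obtain ⟨z, hz⟩ := Finset.card_pos.1 (show 0 < ((T.erase x).erase y).card by omega)
  simp only [Finset.mem_erase] at hz
  refine MacaulayBound.of_card_layer hx hxmax (ih' x hx) fun d A L hA hL hLA => ?_
  obtain ⟨B, hB, hBA, hup, hcomp⟩ := exists_isCompressed ih' hA
  exact ⟨B, hB, hBA, hup, IsCompressed.card_layer_le hx hxmax hy hymax hz.2.1 hz.1 hB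
    (hcomp x hx) (hcomp z hz.2.2) hL (hBA ▸ hLA)⟩

end Macaulay

/-! ### Gotzmann sets of monomials -/

section GotzmannSets

variable {σ : Type*} [LinearOrder σ]

/-- A set of monomials of degree `d` in the variables of `T` that has the fewest multiples among the
sets of monomials of its cardinality. -/
def IsGotzmannSet (T : Finset σ) (d : ℕ) (A : Finset (σ →₀ ℕ)) : Prop :=
  A ⊆ mons T d ∧ ∀ B ⊆ mons T d, B.card = A.card → (up T A).card ≤ (up T B).card

/-- By Macaulay's theorem, it suffices to compare with lexicographic segments. -/
theorem IsGotzmannSet.of_isLexSegment {T : Finset σ} {d : ℕ} {A : Finset (σ →₀ ℕ)}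
    (hA : A ⊆ mons T d)
    (h : ∀ L, IsLexSegment T d L → L.card = A.card → (up T A).card ≤ (up T L).card) :
    IsGotzmannSet T d A := by
  refine ⟨hA, fun B hB hBA => ?_⟩
  obtain ⟨L, hL, hLA⟩ := exists_isLexSegment T d (Finset.card_le_card hA)
  exact (h L hL hLA).trans (macaulayBound T hB hL (hLA.trans hBA.symm).le)

/-- A Gotzmann set has at most as many multiples as any set with at least as many elements. -/
theorem IsGotzmannSet.card_up_le {T : Finset σ} {d : ℕ} {A B : Finset (σ →₀ ℕ)}
    (hA : IsGotzmannSet T d A) (hB : B ⊆ mons T d) (h : A.card ≤ B.card) :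
    (up T A).card ≤ (up T B).card := by
  obtain ⟨C, hC, hCA⟩ := Finset.exists_subset_card_eq h
  exact (hA.2 C (hC.trans hB) hCA).trans (Finset.card_le_card (up_mono hC))

theorem up_image_add (T : Finset σ) (A : Finset (σ →₀ ℕ)) (c : σ →₀ ℕ) :
    up T (A.image (· + c)) = (up T A).image (· + c) := by
  ext b
  simp only [mem_up, Finset.mem_image]
  constructor
  · rintro ⟨_, ⟨a, ha, rfl⟩, i, hi, rfl⟩
    exact ⟨_, ⟨a, ha, i, hi, rfl⟩, add_right_comm _ _ _⟩
  · rintro ⟨_, ⟨a, ha, i, hi, rfl⟩, rfl⟩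
    exact ⟨_, ⟨a, ha, rfl⟩, i, hi, add_right_comm _ _ _⟩

theorem image_add_single_subset_mons {T : Finset σ} {d : ℕ} {A : Finset (σ →₀ ℕ)}
    (hA : A ⊆ mons T d) {x : σ} (hx : x ∈ T) :
    A.image (· + Finsupp.single x 1) ⊆ mons T (d + 1) := by
  intro b hb
  obtain ⟨a, ha, rfl⟩ := Finset.mem_image.1 hb
  exact add_single_mem_mons (hA ha) hx

theorem mem_image_add_single_mons {T : Finset σ} {d : ℕ} {x : σ} {a : σ →₀ ℕ}
    (ha : a ∈ mons T (d + 1)) :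
    a ∈ (mons T d).image (· + Finsupp.single x 1) ↔ a x ≠ 0 := by
  rw [Finset.mem_image]
  constructor
  · rintro ⟨b, _, rfl⟩
    simp
  · intro h
    obtain ⟨b, rfl⟩ := exists_add_single h
    exact ⟨b, mem_mons_of_add_single ha, rfl⟩

/-- The multiples of the largest variable form a lexicographic segment. -/
theorem isLexSegment_image_add_single {T : Finset σ} {z : σ} (hz : z ∈ T) (hmin : ∀ y ∈ T, z ≤ y)
    (d : ℕ) : IsLexSegment T (d + 1) ((mons T d).image (· + Finsupp.single z 1)) := by
  refine ⟨image_add_single_subset_mons subset_rfl hz, fun a ha b hb hab => ?_⟩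
  have ha' := image_add_single_subset_mons subset_rfl hz ha
  rw [mem_image_add_single_mons ha'] at ha
  rw [mem_image_add_single_mons hb]
  intro h0
  refine hab.not_gt (Finsupp.Lex.lt_iff.2 ⟨z, fun r hr => ?_, ?_⟩)
  · have hrT : r ∉ T := fun h => hr.not_ge (hmin r h)
    exact (Finsupp.notMem_support_iff.1 fun h => hrT ((mem_mons.1 hb).2 h)).trans
      (Finsupp.notMem_support_iff.1 fun h => hrT ((mem_mons.1 ha').2 h)).symm
  · exact (h0.trans_lt (Nat.pos_of_ne_zero ha) :)

theorem IsGotzmannSet.image_add_single {T : Finset σ} {d : ℕ} {A : Finset (σ →₀ ℕ)}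
    (hA : IsGotzmannSet T d A) {x : σ} (hx : x ∈ T) :
    IsGotzmannSet T (d + 1) (A.image (· + Finsupp.single x 1)) := by
  refine .of_isLexSegment (image_add_single_subset_mons hA.1 hx) fun L hL hLA => ?_
  obtain ⟨z, hz, hmin⟩ := Finset.exists_min_image T id ⟨x, hx⟩
  have hsub : L ⊆ (mons T d).image (· + Finsupp.single z 1) := by
    refine hL.subset_of_card_le (isLexSegment_image_add_single hz hmin d) ?_
    rw [hLA, Finset.card_image_of_injective _ (add_left_injective _),
      Finset.card_image_of_injective _ (add_left_injective _)]
    exact Finset.card_le_card hA.1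
  obtain ⟨B, hB, rfl⟩ := Finset.subset_image_iff.1 hsub
  rw [Finset.card_image_of_injective _ (add_left_injective _),
    Finset.card_image_of_injective _ (add_left_injective _)] at hLA
  rw [up_image_add, up_image_add, Finset.card_image_of_injective _ (add_left_injective _),
    Finset.card_image_of_injective _ (add_left_injective _)]
  exact hA.2 B hB hLA

theorem mapDomain_equiv_mem_mons {T : Finset σ} {d : ℕ} (e : σ ≃ σ) {a : σ →₀ ℕ}
    (ha : a ∈ mons T d) : a.mapDomain e ∈ mons (T.image e) d := by
  rw [mem_mons] at ha ⊢
  refine ⟨by rw [Finsupp.degree_mapDomain, ha.1], fun k hk => ?_⟩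
  rw [Finsupp.mem_support_iff, Finsupp.mapDomain_equiv_apply] at hk
  exact Finset.mem_image.2 ⟨_, ha.2 (Finsupp.mem_support_iff.2 hk), e.apply_symm_apply k⟩

theorem up_image_mapDomain (T : Finset σ) (A : Finset (σ →₀ ℕ)) (e : σ ≃ σ) :
    up (T.image e) (A.image (Finsupp.mapDomain e)) = (up T A).image (Finsupp.mapDomain e) := by
  ext b
  simp only [mem_up, Finset.mem_image]
  constructor
  · rintro ⟨_, ⟨a, ha, rfl⟩, _, ⟨i, hi, rfl⟩, rfl⟩
    exact ⟨_, ⟨a, ha, i, hi, rfl⟩, by rw [Finsupp.mapDomain_add, Finsupp.mapDomain_single]⟩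
  · rintro ⟨_, ⟨a, ha, i, hi, rfl⟩, rfl⟩
    exact ⟨_, ⟨a, ha, rfl⟩, _, ⟨i, hi, rfl⟩,
      by rw [Finsupp.mapDomain_add, Finsupp.mapDomain_single]⟩

/-- Being a Gotzmann set for all variables but one does not depend on which one is left out. -/
theorem IsGotzmannSet.card_up_le_erase {T : Finset σ} {d : ℕ} {x z : σ} (hx : x ∈ T) (hz : z ∈ T)
    {A B : Finset (σ →₀ ℕ)} (hA : IsGotzmannSet (T.erase x) d A) (hB : B ⊆ mons (T.erase z) d)
    (hBA : B.card = A.card) : (up (T.erase x) A).card ≤ (up (T.erase z) B).card := by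
  set e := Equiv.swap x z with he
  have hinj : Function.Injective (Finsupp.mapDomain e : (σ →₀ ℕ) → (σ →₀ ℕ)) :=
    Finsupp.mapDomain_injective e.injective
  have hT : (T.erase z).image e = T.erase x := by
    ext k
    simp only [Finset.mem_image, Finset.mem_erase]
    constructor
    · rintro ⟨i, ⟨hiz, hi⟩, rfl⟩
      by_cases hix : i = x
      · subst hix
        simp [he, hz, Ne.symm hiz]
      · rw [he, Equiv.swap_apply_of_ne_of_ne hix hiz]
        exact ⟨hix, hi⟩
    · rintro ⟨hkx, hk⟩
      refine ⟨e k, ⟨?_, ?_⟩, by simp [he]⟩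
      · intro h
        refine hkx (e.injective ?_)
        rw [h, he, Equiv.swap_apply_left]
      · by_cases hkz : k = z
        · subst hkz
          simp [he, hx]
        · rwa [he, Equiv.swap_apply_of_ne_of_ne hkx hkz]
  have h1 := hA.2 (B.image (Finsupp.mapDomain e)) (fun b hb => by
    obtain ⟨a, ha, rfl⟩ := Finset.mem_image.1 hb
    exact hT ▸ mapDomain_equiv_mem_mons e (hB ha))
    (by rw [Finset.card_image_of_injective _ hinj, hBA])
  rw [← hT, up_image_mapDomain, Finset.card_image_of_injective _ hinj] at h1
  rwa [← hT]

theorem card_image_mons_union {T : Finset σ} {x : σ} (d : ℕ)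
    {A : Finset (σ →₀ ℕ)} {e : ℕ} (hA : A ⊆ mons (T.erase x) e) :
    ((mons T d).image (· + Finsupp.single x 1) ∪ A).card = (mons T d).card + A.card := by
  rw [Finset.card_union_of_disjoint,
    Finset.card_image_of_injective _ (add_left_injective (Finsupp.single x 1))]
  rw [Finset.disjoint_left]
  intro a ha ha'
  obtain ⟨b, _, rfl⟩ := Finset.mem_image.1 ha
  have hx : x ∈ T.erase x := (mem_mons.1 (hA ha')).2 (by simp)
  simp at hx

theorem up_image_mons_union {T : Finset σ} {x : σ} (hx : x ∈ T) (d : ℕ)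
    {A : Finset (σ →₀ ℕ)} (hA : A ⊆ mons (T.erase x) (d + 1)) :
    up T ((mons T d).image (· + Finsupp.single x 1) ∪ A) =
      (mons T (d + 1)).image (· + Finsupp.single x 1) ∪ up (T.erase x) A := by
  rw [up_union, up_image_add, up_mons]
  refine (Finset.union_subset Finset.subset_union_left fun b hb => ?_).antisymm
    (Finset.union_subset_union_right ?_)
  · obtain ⟨a, ha, i, hi, rfl⟩ := mem_up.1 hb
    by_cases hix : i = x
    · subst hix
      exact Finset.mem_union_left _
        (Finset.mem_image_of_mem _ (mons_mono (Finset.erase_subset _ _) _ (hA ha)))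
    · exact Finset.mem_union_right _ (add_single_mem_up ha (Finset.mem_erase.2 ⟨hix, hi⟩))
  · intro b hb
    obtain ⟨a, ha, i, hi, rfl⟩ := mem_up.1 hb
    exact add_single_mem_up ha (Finset.mem_of_mem_erase hi)

/-- Adjoining all multiples of a new variable preserves Gotzmann sets. -/
theorem IsGotzmannSet.image_mons_union {T : Finset σ} {d : ℕ} {x : σ} (hx : x ∈ T)
    {A : Finset (σ →₀ ℕ)} (hA : IsGotzmannSet (T.erase x) (d + 1) A) :
    IsGotzmannSet T (d + 1) ((mons T d).image (· + Finsupp.single x 1) ∪ A) := by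
  refine .of_isLexSegment (Finset.union_subset (image_add_single_subset_mons subset_rfl hx)
    (hA.1.trans (mons_mono (Finset.erase_subset _ _) _))) fun L hL hLA => ?_
  rw [card_image_mons_union d hA.1] at hLA
  obtain ⟨z, hz, hmin⟩ := Finset.exists_min_image T id ⟨x, hx⟩
  have hseg := isLexSegment_image_add_single hz hmin d
  have hsub : (mons T d).image (· + Finsupp.single z 1) ⊆ L := by
    refine hseg.subset_of_card_le hL ?_
    rw [Finset.card_image_of_injective _ (add_left_injective _), hLA]
    exact Nat.le_add_right _ _
  -- `L` consists of all multiples of `z` and of a set `B` of monomials not involving `z`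
  set B := L \ (mons T d).image (· + Finsupp.single z 1) with hB
  have hBm : B ⊆ mons (T.erase z) (d + 1) := by
    intro b hb
    obtain ⟨hbL, hbz⟩ := Finset.mem_sdiff.1 hb
    rw [mem_image_add_single_mons (hL.1 hbL), not_not] at hbz
    have := mem_mons.1 (hL.1 hbL)
    refine mem_mons.2 ⟨this.1, fun k hk => Finset.mem_erase.2 ⟨?_, this.2 hk⟩⟩
    rintro rfl
    exact Finsupp.mem_support_iff.1 hk hbz
  have hLB : (mons T d).image (· + Finsupp.single z 1) ∪ B = L := Finset.union_sdiff_of_subset hsub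
  rw [← hLB, card_image_mons_union d hBm] at hLA
  rw [← hLB, up_image_mons_union hz d hBm, up_image_mons_union hx d hA.1,
    card_image_mons_union _ (up_subset_mons hBm), card_image_mons_union _ (up_subset_mons hA.1)]
  exact Nat.add_le_add_left (hA.card_up_le_erase hx hz hBm (by omega)) _

/-- The monomials of degree `d` in the variables of `T` of the ideal generated by the squarefree
monomials whose supports belong to `G`. -/
noncomputable def idealMons (T : Finset σ) (G : Finset (Finset σ)) (d : ℕ) : Finset (σ →₀ ℕ) :=
  (mons T d).filter fun a => ∃ g ∈ G, g ⊆ a.support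

/-- The squarefree monomial ideal generated by `G` in the variables of `T` is Gotzmann, in terms of
monomials. -/
def IsGotzmannFamily (T : Finset σ) (G : Finset (Finset σ)) : Prop :=
  ∀ d, IsGotzmannSet T d (idealMons T G d)

theorem mem_idealMons {T : Finset σ} {G : Finset (Finset σ)} {d : ℕ} {a : σ →₀ ℕ} :
    a ∈ idealMons T G d ↔ a ∈ mons T d ∧ ∃ g ∈ G, g ⊆ a.support := by
  rw [idealMons, Finset.mem_filter]

theorem idealMons_subset (T : Finset σ) (G : Finset (Finset σ)) (d : ℕ) :
    idealMons T G d ⊆ mons T d := Finset.filter_subset _ _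

/-- Setting a variable to zero preserves Gotzmann squarefree monomial ideals. -/
theorem IsGotzmannFamily.filter_notMem {T : Finset σ} {G : Finset (Finset σ)}
    (hG : IsGotzmannFamily T G) {x : σ} (hx : x ∈ T) :
    IsGotzmannFamily (T.erase x) (G.filter fun g => x ∉ g) := by
  intro d
  have hl : layer x 0 (idealMons T G d) = idealMons (T.erase x) (G.filter fun g => x ∉ g) d := by
    ext a
    simp only [mem_layer, Finsupp.single_zero, add_zero, mem_idealMons, mem_mons,
      Finset.mem_filter, Finset.subset_erase]
    constructor
    · rintro ⟨h0, ⟨h1, h2⟩, g, hg, hga⟩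
      have hxa : x ∉ a.support := by simpa using h0
      exact ⟨⟨h1, h2, hxa⟩, g, ⟨hg, fun h => hxa (hga h)⟩, hga⟩
    · rintro ⟨⟨h1, h2, hxa⟩, g, ⟨hg, _⟩, hga⟩
      exact ⟨by simpa using hxa, ⟨h1, h2⟩, g, hg, hga⟩
  refine .of_isLexSegment (idealMons_subset _ _ _) fun L hL hLA => ?_
  obtain ⟨C, hC, hCA⟩ := exists_compression hx d _ (idealMons_subset T G d)
  have h1 := (macaulayBound (T.erase x)).compression hx (idealMons_subset T G d) hC hCA
  have hcard : C.card = (idealMons T G d).card := by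
    rw [← card_eq_sum_layer x hC, ← card_eq_sum_layer x (idealMons_subset T G d)]
    exact Finset.sum_congr rfl fun j hj => (hCA j (Nat.lt_succ_iff.1 (Finset.mem_range.1 hj))).2
  have h2 := (hG d).2 C hC hcard
  have hC0 := hCA 0 (Nat.zero_le d)
  have hLC : L = layer x 0 C := by
    have hc : L.card = (layer x 0 C).card := by rw [hLA, hC0.2, hl]
    exact (hL.subset_of_card_le hC0.1 hc.le).antisymm (hC0.1.subset_of_card_le hL hc.ge)
  rw [hLC, ← hl]
  omega

end GotzmannSets

/-! ### Nested families -/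

section NestedFamilies

variable {σ : Type*} [LinearOrder σ]

/-- A family of sets is nested by a choice `y` of an element of each member if it is an antichain
and the sets `g \ {y g}` increase with the cardinality of `g` (in particular, those of equal
cardinality coincide). -/
structure IsNestedBy (G : Finset (Finset σ)) (y : Finset σ → σ) : Prop where
  antichain : IsAntichain (· ⊆ ·) (G : Set (Finset σ))
  mem : ∀ g ∈ G, y g ∈ g
  mono : ∀ g ∈ G, ∀ h ∈ G, g.card ≤ h.card → g.erase (y g) ⊆ h.erase (y h)

/-- A family that is nested by some choice of elements. The empty family is singled out because
there is no choice function if there are no variables at all. -/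
def IsNested (G : Finset (Finset σ)) : Prop := G = ∅ ∨ ∃ y, IsNestedBy G y

namespace IsNestedBy

variable {G : Finset (Finset σ)} {y : Finset σ → σ}

theorem notMem_erase (hG : IsNestedBy G y) {g h : Finset σ} (hg : g ∈ G) (hh : h ∈ G) :
    y g ∉ h.erase (y h) := by
  intro hy
  rcases eq_or_ne g h with rfl | hgh
  · simp at hy
  rcases le_total g.card h.card with hc | hc
  · refine hgh (hG.antichain.eq hg hh ?_)
    rw [← Finset.insert_erase (hG.mem g hg)]
    exact Finset.insert_subset (Finset.mem_of_mem_erase hy)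
      ((hG.mono g hg h hh hc).trans (Finset.erase_subset _ _))
  · simpa using hG.mono h hh g hg hc hy

theorem injOn (hG : IsNestedBy G y) : Set.InjOn y G := by
  have key : ∀ g ∈ G, ∀ h ∈ G, g.card ≤ h.card → y g = y h → g = h := by
    intro g hg h hh hc hy
    refine hG.antichain.eq hg hh ?_
    rw [← Finset.insert_erase (hG.mem g hg), ← Finset.insert_erase (hG.mem h hh), hy]
    refine Finset.insert_subset_insert _ ?_
    rw [← hy]
    nth_rewrite 2 [hy]
    exact hG.mono g hg h hh hc
  intro g hg h hh hy
  rcases le_total g.card h.card with hc | hc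
  · exact key g hg h hh hc hy
  · exact (key h hh g hg hc hy.symm).symm

theorem notMem (hG : IsNestedBy G y) {g h : Finset σ} (hg : g ∈ G) (hh : h ∈ G) (hgh : g ≠ h) :
    y g ∉ h := fun hy => by
  by_cases h1 : y g = y h
  · exact hgh (hG.injOn hg hh h1)
  · exact hG.notMem_erase hg hh (Finset.mem_erase.2 ⟨h1, hy⟩)

theorem card_add_card_le (hG : IsNestedBy G y) {T : Finset σ} (hT : ∀ g ∈ G, g ⊆ T) {g : Finset σ}
    (hg : g ∈ G) : G.card + g.card ≤ T.card + 1 := by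
  have hsub : G.image y ∪ g.erase (y g) ⊆ T := by
    refine Finset.union_subset (fun x hx => ?_) ((Finset.erase_subset _ _).trans (hT g hg))
    obtain ⟨h, hh, rfl⟩ := Finset.mem_image.1 hx
    exact hT h hh (hG.mem h hh)
  have h1 := Finset.card_le_card hsub
  rw [Finset.card_union_of_disjoint, Finset.card_image_of_injOn hG.injOn,
    Finset.card_erase_of_mem (hG.mem g hg)] at h1
  · have := Finset.card_pos.2 ⟨_, hG.mem g hg⟩
    omega
  · rw [Finset.disjoint_left]
    intro x hx
    obtain ⟨h, hh, rfl⟩ := Finset.mem_image.1 hx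
    exact hG.notMem_erase hh hg

theorem subset (hG : IsNestedBy G y) {F : Finset (Finset σ)} (hF : F ⊆ G) : IsNestedBy F y where
  antichain := hG.antichain.subset hF
  mem g hg := hG.mem g (hF hg)
  mono g hg h hh := hG.mono g (hF hg) h (hF hh)

/-- Removing an element that lies in all the sets `g \ {y g}` preserves nestedness. -/
theorem image_erase (hG : IsNestedBy G y) {x : σ} (hx : ∀ g ∈ G, x ∈ g.erase (y g)) :
    IsNestedBy (G.image (·.erase x)) fun g => y (insert x g) := by
  have hx' : ∀ g ∈ G, insert x (g.erase x) = g := fun g hg =>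
    Finset.insert_erase (Finset.mem_of_mem_erase (hx g hg))
  refine ⟨?_, ?_, ?_⟩
  · simp only [IsAntichain, Set.Pairwise, Finset.coe_image, Set.mem_image, Finset.mem_coe,
      forall_exists_index, and_imp, forall_apply_eq_imp_iff₂]
    intro g hg h hh hgh hsub
    have : g ⊆ h := by
      rw [← hx' g hg, ← hx' h hh]
      exact Finset.insert_subset_insert _ hsub
    exact hgh (by rw [hG.antichain.eq hg hh this])
  · simp only [Finset.mem_image, forall_exists_index, and_imp, forall_apply_eq_imp_iff₂]
    intro g hg
    rw [hx' g hg]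
    exact Finset.mem_erase.2 ⟨(Finset.ne_of_mem_erase (hx g hg)).symm, hG.mem g hg⟩
  · simp only [Finset.mem_image, forall_exists_index, and_imp, forall_apply_eq_imp_iff₂]
    intro g hg h hh hc
    rw [hx' g hg, hx' h hh, Finset.erase_right_comm, Finset.erase_right_comm (s := h)]
    refine Finset.erase_subset_erase _ (hG.mono g hg h hh ?_)
    rw [← hx' g hg, ← hx' h hh]
    simp [hc]

end IsNestedBy

theorem isGotzmannSet_empty (T : Finset σ) (d : ℕ) : IsGotzmannSet T d ∅ :=
  ⟨by simp, by simp [up]⟩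

theorem idealMons_zero {T : Finset σ} {G : Finset (Finset σ)} (hG : ∅ ∉ G) :
    idealMons T G 0 = ∅ := by
  refine Finset.eq_empty_of_forall_notMem fun a ha => ?_
  obtain ⟨h1, g, hg, hga⟩ := mem_idealMons.1 ha
  rw [mem_mons, Finsupp.degree_eq_zero_iff] at h1
  rw [h1.1, Finsupp.support_zero, Finset.subset_empty] at hga
  exact hG (hga ▸ hg)

theorem isGotzmannFamily_empty (T : Finset σ) : IsGotzmannFamily T ∅ := fun d => by
  simpa [idealMons] using isGotzmannSet_empty T d

/-- Nested families generate Gotzmann ideals: multiplying by a variable and adjoining a new variable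
preserve the Gotzmann property. -/
theorem IsNestedBy.isGotzmannFamily {T : Finset σ} {G : Finset (Finset σ)} {y : Finset σ → σ}
    (hG : IsNestedBy G y) (hT : ∀ g ∈ G, g ⊆ T) : IsGotzmannFamily T G := by
  induction hn : (G.biUnion id).card using Nat.strong_induction_on generalizing T G y with
  | _ n ih =>
  have h0 : ∅ ∉ G := fun h => by simpa using hG.mem _ h
  intro d
  rcases d with _ | d
  · rw [idealMons_zero h0]
    exact isGotzmannSet_empty T 0
  rcases G.eq_empty_or_nonempty with rfl | hne
  · exact isGotzmannFamily_empty T (d + 1)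
  obtain ⟨g, hg, hmin⟩ := Finset.exists_min_image G Finset.card hne
  rcases (g.erase (y g)).eq_empty_or_nonempty with hC | ⟨x, hxg⟩
  · -- a generator of degree one
    set x := y g with hxdef
    have hgx : g = {x} := by
      rw [← Finset.insert_erase (hG.mem g hg), hC]
      rfl
    have hxT : x ∈ T := hT g hg (hG.mem g hg)
    have hnot : ∀ h ∈ G.erase g, x ∉ h := fun h hh =>
      hG.notMem hg (Finset.mem_of_mem_erase hh) (Finset.ne_of_mem_erase hh).symm
    have hcard : ((G.erase g).biUnion id).card < n := by
      rw [← hn]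
      refine Finset.card_lt_card ⟨Finset.biUnion_subset_biUnion_of_subset_left _
        (Finset.erase_subset _ _), fun h => ?_⟩
      have := h (Finset.mem_biUnion.2 ⟨g, hg, hG.mem g hg⟩)
      obtain ⟨h', hh', hxh'⟩ := Finset.mem_biUnion.1 this
      exact hnot h' hh' hxh'
    have h1 := ih _ hcard (hG.subset (Finset.erase_subset g G)) (T := T.erase x) (fun h hh =>
      Finset.subset_erase.2 ⟨hT h (Finset.mem_of_mem_erase hh), hnot h hh⟩) rfl (d + 1)
    convert h1.image_mons_union hxT using 1
    ext a
    rw [Finset.mem_union, mem_idealMons, mem_idealMons]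
    constructor
    · rintro ⟨ha, h, hh, hha⟩
      rw [mem_image_add_single_mons ha]
      by_cases hax : a x = 0
      · have hxa : x ∉ a.support := by simpa using hax
        refine Or.inr ⟨mem_mons.2 ⟨(mem_mons.1 ha).1,
          Finset.subset_erase.2 ⟨(mem_mons.1 ha).2, hxa⟩⟩, h, Finset.mem_erase.2 ⟨?_, hh⟩, hha⟩
        rintro rfl
        exact hxa (hha (hG.mem h hg))
      · exact Or.inl hax
    · rintro (ha | ⟨ha, h, hh, hha⟩)
      · have ha' := image_add_single_subset_mons subset_rfl hxT ha
        rw [mem_image_add_single_mons ha'] at ha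
        exact ⟨ha', g, hg, by simpa [hgx] using ha⟩
      · exact ⟨mons_mono (Finset.erase_subset _ _) _ ha, h, Finset.mem_of_mem_erase hh, hha⟩
  · -- a variable that divides all generators
    have hx : ∀ h ∈ G, x ∈ h.erase (y h) := fun h hh => hG.mono g hg h hh (hmin h hh) hxg
    have hx' : ∀ h ∈ G, x ∈ h := fun h hh => Finset.mem_of_mem_erase (hx h hh)
    have hcard : ((G.image (·.erase x)).biUnion id).card < n := by
      rw [← hn]
      refine Finset.card_lt_card ⟨fun i hi => ?_, fun h => ?_⟩
      · simp only [Finset.mem_biUnion, Finset.mem_image, exists_exists_and_eq_and, id] at hi ⊢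
        obtain ⟨h, hh, hi⟩ := hi
        exact ⟨h, hh, Finset.mem_of_mem_erase hi⟩
      · have := h (Finset.mem_biUnion.2 ⟨g, hg, hx' g hg⟩)
        simp at this
    have hxT := hT g hg (hx' g hg)
    have h1 := ih _ hcard (hG.image_erase hx) (T := T) (fun h hh => by
      obtain ⟨h', hh', rfl⟩ := Finset.mem_image.1 hh
      exact (Finset.erase_subset _ _).trans (hT h' hh')) rfl d
    convert h1.image_add_single hxT using 1
    ext a
    simp only [mem_idealMons, Finset.mem_image, exists_exists_and_eq_and]
    constructor
    · rintro ⟨ha, h, hh, hha⟩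
      obtain ⟨b, rfl⟩ := exists_add_single (Finsupp.mem_support_iff.1 (hha (hx' h hh)))
      refine ⟨b, ⟨mem_mons_of_add_single ha, h, hh, fun i hi => ?_⟩, rfl⟩
      obtain ⟨hix, hi⟩ := Finset.mem_erase.1 hi
      simpa [Finsupp.single_eq_of_ne hix] using hha hi
    · rintro ⟨b, ⟨hb, h, hh, hhb⟩, rfl⟩
      refine ⟨add_single_mem_mons hb hxT, h, hh, fun i hi => ?_⟩
      by_cases hix : i = x
      · simp [hix]
      · simpa [Finsupp.single_eq_of_ne hix] using hhb (Finset.mem_erase.2 ⟨hix, hi⟩)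

theorem IsNested.isGotzmannFamily {T : Finset σ} {G : Finset (Finset σ)} (hG : IsNested G)
    (hT : ∀ g ∈ G, g ⊆ T) : IsGotzmannFamily T G := by
  rcases hG with rfl | ⟨y, hG⟩
  · exact isGotzmannFamily_empty T
  · exact hG.isGotzmannFamily hT

/-- The condition on an antichain that, for each member `g`, the sets `h \ g`, where `h` runs over
the other members of at most the same cardinality, are distinct singletons. For the squarefree
monomial ideal it says that, if the generators are ordered by degree, each colon ideal of the
preceding generators by the next one is generated by as many variables as there are preceding
generators. -/
def HasSingletonDiffs (G : Finset (Finset σ)) : Prop :=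
  ∀ g ∈ G, ∀ h ∈ G, h ≠ g → h.card ≤ g.card →
    (h \ g).card = 1 ∧ ∀ h' ∈ G, h' ≠ g → h'.card ≤ g.card → h \ g = h' \ g → h = h'

theorem HasSingletonDiffs.sdiff_eq {G : Finset (Finset σ)} (hG : HasSingletonDiffs G)
    {g h h' : Finset σ} (hg : g ∈ G) (hh : h ∈ G) (hh' : h' ∈ G) (hne : h ≠ g) (hne' : h' ≠ g)
    (hc : g.card ≤ h.card) (hc' : g.card ≤ h'.card) : g \ h = g \ h' := by
  wlog hhh : h.card ≤ h'.card generalizing h h'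
  · exact (this hh' hh hne' hne hc' hc (le_of_not_ge hhh)).symm
  rcases eq_or_ne h h' with rfl | hn
  · rfl
  obtain ⟨a, ha⟩ := Finset.card_eq_one.1 (hG h hh g hg hne.symm hc).1
  obtain ⟨b, hb⟩ := Finset.card_eq_one.1 (hG h' hh' g hg hne'.symm hc').1
  obtain ⟨c, hc1⟩ := Finset.card_eq_one.1 (hG h' hh' h hh hn hhh).1
  have hbg : b ∈ g \ h' := hb ▸ Finset.mem_singleton_self b
  rw [Finset.mem_sdiff] at hbg
  by_cases hbh : b ∈ h
  · have hbc : b ∈ h \ h' := Finset.mem_sdiff.2 ⟨hbh, hbg.2⟩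
    rw [hc1, Finset.mem_singleton] at hbc
    exact absurd ((hG h' hh' h hh hn hhh).2 g hg hne'.symm hc' (by rw [hc1, hb, hbc])) hne
  · have hba : b ∈ g \ h := Finset.mem_sdiff.2 ⟨hbg.1, hbh⟩
    rw [ha, Finset.mem_singleton] at hba
    rw [ha, hb, hba]

theorem HasSingletonDiffs.isNested {G : Finset (Finset σ)} (hG : HasSingletonDiffs G)
    (hanti : IsAntichain (· ⊆ ·) (G : Set (Finset σ))) (h0 : ∅ ∉ G) : IsNested G := by
  have key : ∀ g ∈ G, ∃ y ∈ g, (∀ h ∈ G, h ≠ g → y ∉ h) ∧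
      ∀ h ∈ G, h ≠ g → g.card ≤ h.card → g \ h = {y} := by
    intro g hg
    by_cases htop : ∃ h ∈ G, h ≠ g ∧ g.card ≤ h.card
    · obtain ⟨h₀, hh₀, hne₀, hc₀⟩ := htop
      obtain ⟨y, hy⟩ := Finset.card_eq_one.1 (hG h₀ hh₀ g hg hne₀.symm hc₀).1
      have hyg : y ∈ g \ h₀ := hy ▸ Finset.mem_singleton_self y
      rw [Finset.mem_sdiff] at hyg
      have hsd : ∀ h ∈ G, h ≠ g → g.card ≤ h.card → g \ h = {y} := fun h hh hne hc => by
        rw [← hy]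
        exact hG.sdiff_eq hg hh hh₀ hne hne₀ hc hc₀
      refine ⟨y, hyg.1, fun h hh hne hyh => ?_, hsd⟩
      rcases le_total g.card h.card with hc | hc
      · have : y ∈ g \ h := hsd h hh hne hc ▸ Finset.mem_singleton_self y
        exact (Finset.mem_sdiff.1 this).2 hyh
      · have hhh₀ : h ≠ h₀ := by
          rintro rfl
          exact hyg.2 hyh
        obtain ⟨h1, h2⟩ := hG h₀ hh₀ h hh hhh₀ (hc.trans hc₀)
        obtain ⟨z, hz⟩ := Finset.card_eq_one.1 h1
        have hyz : y ∈ h \ h₀ := Finset.mem_sdiff.2 ⟨hyh, hyg.2⟩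
        rw [hz, Finset.mem_singleton] at hyz
        exact hne (h2 g hg hne₀.symm hc₀ (by rw [hz, hy, hyz]))
    · push Not at htop
      have hvac : ∀ y, ∀ h ∈ G, h ≠ g → g.card ≤ h.card → g \ h = {y} :=
        fun y h hh hne hc => absurd (htop h hh hne) hc.not_gt
      rcases (G.erase g).eq_empty_or_nonempty with he | he
      · obtain ⟨y, hy⟩ := Finset.nonempty_iff_ne_empty.2 fun h : g = ∅ => h0 (h ▸ hg)
        refine ⟨y, hy, fun h hh hne => ?_, hvac y⟩
        have := Finset.mem_erase.2 ⟨hne, hh⟩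
        simp [he] at this
      · obtain ⟨h₁, hh₁, hmax⟩ := Finset.exists_max_image _ Finset.card he
        obtain ⟨hne₁, hh₁⟩ := Finset.mem_erase.1 hh₁
        obtain ⟨y, hyg, hyh₁⟩ := Finset.not_subset.1 fun h => hne₁ (hanti.eq hg hh₁ h).symm
        refine ⟨y, hyg, fun h hh hne hyh => ?_, hvac y⟩
        have hhh₁ : h ≠ h₁ := by
          rintro rfl
          exact hyh₁ hyh
        -- `h \ h₁ = h \ g`, hence `h ∩ g ⊆ h₁`
        have h1 := hG.sdiff_eq hh hh₁ hg hhh₁.symm hne.symm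
          (hmax h (Finset.mem_erase.2 ⟨hne, hh⟩)) (htop h hh hne).le
        have h2 : y ∈ h \ h₁ := Finset.mem_sdiff.2 ⟨hyh, hyh₁⟩
        rw [h1] at h2
        exact (Finset.mem_sdiff.1 h2).2 hyg
  rcases G.eq_empty_or_nonempty with he | ⟨g₀, hg₀⟩
  · exact Or.inl he
  have : ∀ g, ∃ y, g ∈ G → y ∈ g ∧ (∀ h ∈ G, h ≠ g → y ∉ h) ∧
      ∀ h ∈ G, h ≠ g → g.card ≤ h.card → g \ h = {y} := fun g => by
    by_cases hg : g ∈ G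
    · obtain ⟨y, hy⟩ := key g hg
      exact ⟨y, fun _ => hy⟩
    · exact ⟨(key g₀ hg₀).choose, fun h => absurd h hg⟩
  choose y hy using this
  refine Or.inr ⟨y, hanti, fun g hg => (hy g hg).1, fun g hg h hh hc => ?_⟩
  rcases eq_or_ne g h with rfl | hne
  · rfl
  · intro i hi
    obtain ⟨hiy, hi⟩ := Finset.mem_erase.1 hi
    refine Finset.mem_erase.2 ⟨?_, ?_⟩
    · rintro rfl
      exact (hy h hh).2.1 g hg hne hi
    · by_contra hih
      have : i ∈ g \ h := Finset.mem_sdiff.2 ⟨hi, hih⟩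
      rw [(hy g hg).2.2 h hh hne.symm hc, Finset.mem_singleton] at this
      exact hiy this

end NestedFamilies

/-! ### Gotzmann families are nested -/

section Classification

variable {σ : Type*} [LinearOrder σ]

/-- The exponent vector of the squarefree monomial with support `g`. -/
noncomputable def sqfreeExponent (g : Finset σ) : σ →₀ ℕ := Finsupp.indicator g fun _ _ => 1

theorem sqfreeExponent_apply (g : Finset σ) (i : σ) :
    sqfreeExponent g i = if i ∈ g then 1 else 0 := by
  simp [sqfreeExponent, Finsupp.indicator_apply]

theorem support_sqfreeExponent (g : Finset σ) : (sqfreeExponent g).support = g := by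
  ext i
  simp [sqfreeExponent_apply]

theorem degree_sqfreeExponent (g : Finset σ) : (sqfreeExponent g).degree = g.card := by
  rw [Finsupp.degree_apply, support_sqfreeExponent,
    Finset.sum_congr rfl fun i hi => (sqfreeExponent_apply g i).trans (if_pos hi)]
  simp

theorem sqfreeExponent_mem_mons {T g : Finset σ} (hg : g ⊆ T) :
    sqfreeExponent g ∈ mons T g.card :=
  mem_mons.2 ⟨degree_sqfreeExponent g, by rwa [support_sqfreeExponent]⟩

theorem sqfreeExponent_le_iff {g : Finset σ} {a : σ →₀ ℕ} :
    sqfreeExponent g ≤ a ↔ g ⊆ a.support := by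
  constructor
  · intro h
    rw [← support_sqfreeExponent g]
    exact Finsupp.support_mono h
  · intro h i
    rw [sqfreeExponent_apply]
    split_ifs with hi
    · exact Nat.one_le_iff_ne_zero.2 (Finsupp.mem_support_iff.1 (h hi))
    · exact Nat.zero_le _

/-- A monomial of degree `|g|` divisible by the squarefree monomial of `g` equals it. -/
theorem eq_sqfreeExponent {T g : Finset σ} {a : σ →₀ ℕ} (ha : a ∈ mons T g.card)
    (h : g ⊆ a.support) : a = sqfreeExponent g := by
  obtain ⟨c, rfl⟩ := exists_add_of_le (sqfreeExponent_le_iff.2 h)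
  have := (mem_mons.1 ha).1
  rw [map_add, degree_sqfreeExponent] at this
  rw [(Finsupp.degree_eq_zero_iff c).1 (by omega), add_zero]

theorem idealMons_insert {T g : Finset σ} (hg : g ⊆ T) (F : Finset (Finset σ)) :
    idealMons T (insert g F) g.card = insert (sqfreeExponent g) (idealMons T F g.card) := by
  ext a
  simp only [mem_idealMons, Finset.mem_insert, exists_eq_or_imp]
  constructor
  · rintro ⟨ha, h | h⟩
    · exact Or.inl (eq_sqfreeExponent ha h)
    · exact Or.inr ⟨ha, h⟩
  · rintro (rfl | ⟨ha, h⟩)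
    · exact ⟨sqfreeExponent_mem_mons hg, Or.inl (support_sqfreeExponent g).ge⟩
    · exact ⟨ha, Or.inr h⟩

theorem card_idealMons_insert {T g : Finset σ} (hg : g ⊆ T) {F : Finset (Finset σ)}
    (hF : ∀ h ∈ F, ¬ h ⊆ g) :
    (idealMons T (insert g F) g.card).card = (idealMons T F g.card).card + 1 := by
  rw [idealMons_insert hg, Finset.card_insert_of_notMem]
  intro h
  obtain ⟨_, h, hh, hsub⟩ := mem_idealMons.1 h
  rw [support_sqfreeExponent] at hsub
  exact hF h hh hsub

/-- The variables `x` such that the product of `x` and the squarefree monomial of `g` lies in the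
ideal generated by `F`, provided that this monomial itself does not. -/
def colonVars (T : Finset σ) (F : Finset (Finset σ)) (g : Finset σ) : Finset σ :=
  T.filter fun x => ∃ h ∈ F, h \ g = {x}

theorem image_colonVars_subset (T : Finset σ) (F : Finset (Finset σ)) (g : Finset σ) :
    (colonVars T F g).image (fun x => ({x} : Finset σ)) ⊆
      (F.filter fun h => (h \ g).card = 1).image (· \ g) := by
  intro s hs
  obtain ⟨x, hx, rfl⟩ := Finset.mem_image.1 hs
  obtain ⟨_, h, hh, hx⟩ := Finset.mem_filter.1 hx
  exact Finset.mem_image.2 ⟨h, Finset.mem_filter.2 ⟨hh, by rw [hx]; rfl⟩, hx⟩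

theorem card_colonVars_le_card_filter (T : Finset σ) (F : Finset (Finset σ)) (g : Finset σ) :
    (colonVars T F g).card ≤ ((F.filter fun h => (h \ g).card = 1).image (· \ g)).card := by
  rw [← Finset.card_image_of_injective _ (Finset.singleton_injective (α := σ))]
  exact Finset.card_le_card (image_colonVars_subset T F g)

theorem card_colonVars_le (T : Finset σ) (F : Finset (Finset σ)) (g : Finset σ) :
    (colonVars T F g).card ≤ F.card :=
  (card_colonVars_le_card_filter T F g).trans
    (Finset.card_image_le.trans (Finset.card_filter_le _ _))

/-- If every member of `F` contributes a variable of its own to the colon ideal, then the sets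
`h \ g` are distinct singletons. -/
theorem singleton_diffs_of_card_colonVars {T : Finset σ} {F : Finset (Finset σ)} {g : Finset σ}
    (h : F.card ≤ (colonVars T F g).card) :
    (∀ h ∈ F, (h \ g).card = 1) ∧ Set.InjOn (· \ g) (F : Set (Finset σ)) := by
  have h1 := h.trans (card_colonVars_le_card_filter T F g)
  have h3 : F.filter (fun h => (h \ g).card = 1) = F :=
    Finset.eq_of_subset_of_card_le (Finset.filter_subset _ _) (h1.trans Finset.card_image_le)
  refine ⟨Finset.filter_eq_self.1 h3, ?_⟩
  rw [h3] at h1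
  exact Finset.card_image_iff.1 (Finset.card_image_le.antisymm h1)

/-- Adjoining a squarefree generator `g` of degree `|g|` adds a new multiple for each variable
outside the colon ideal. -/
theorem card_up_insert_ge {T g : Finset σ} (hg : g ⊆ T) {F : Finset (Finset σ)}
    (hF : ∀ h ∈ F, ¬ h ⊆ g) :
    (up T (idealMons T F g.card)).card + (T.card - (colonVars T F g).card) ≤
      (up T (idealMons T (insert g F) g.card)).card := by
  have hinj : Function.Injective fun x : σ => sqfreeExponent g + Finsupp.single x 1 :=
    (add_right_injective _).comp (Finsupp.single_left_injective one_ne_zero)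
  have hsub : colonVars T F g ⊆ T := Finset.filter_subset _ _
  rw [← Finset.card_sdiff_of_subset hsub,
    ← Finset.card_image_of_injective (T \ colonVars T F g) hinj,
    ← Finset.card_union_of_disjoint]
  · refine Finset.card_le_card (Finset.union_subset (up_mono fun a ha => ?_) fun b hb => ?_)
    · rw [idealMons_insert hg]
      exact Finset.mem_insert_of_mem ha
    · obtain ⟨x, hx, rfl⟩ := Finset.mem_image.1 hb
      refine add_single_mem_up ?_ (Finset.mem_sdiff.1 hx).1
      rw [idealMons_insert hg]
      exact Finset.mem_insert_self _ _
  · rw [Finset.disjoint_right]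
    intro b hb hb'
    obtain ⟨x, hx, rfl⟩ := Finset.mem_image.1 hb
    obtain ⟨hxT, hx⟩ := Finset.mem_sdiff.1 hx
    obtain ⟨a, ha, i, hi, hai⟩ := mem_up.1 hb'
    obtain ⟨_, h, hh, hha⟩ := mem_idealMons.1 ha
    have hsub' : h ⊆ insert x g := by
      intro k hk
      have h1 := Finsupp.mem_support_iff.1 (hha hk)
      have h2 := DFunLike.congr_fun hai k
      by_contra hcon
      rw [Finset.mem_insert, not_or] at hcon
      rw [Finsupp.add_apply, Finsupp.add_apply, sqfreeExponent_apply, if_neg hcon.2,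
        Finsupp.single_eq_of_ne hcon.1] at h2
      omega
    refine hx (Finset.mem_filter.2 ⟨hxT, h, hh, ?_⟩)
    refine (Finset.subset_singleton_iff.1 ?_).resolve_left fun he =>
      hF h hh (Finset.sdiff_eq_empty_iff_subset.1 he)
    intro k hk
    obtain ⟨hkh, hkg⟩ := Finset.mem_sdiff.1 hk
    exact Finset.mem_singleton.2 ((Finset.mem_insert.1 (hsub' hkh)).resolve_right hkg)

/-- Adjoining `q` squarefree generators of the same degree `b` to an antichain `H` adds exactly
`q` monomials of degree `b`, and at least `(n - |H|) + (n - |H| - 1) + ⋯` multiples of them. -/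
theorem card_up_union_ge {T : Finset σ} {H Q : Finset (Finset σ)} {b : ℕ}
    (hanti : IsAntichain (· ⊆ ·) (↑(H ∪ Q) : Set (Finset σ))) (hHQ : Disjoint H Q)
    (hQT : ∀ g ∈ Q, g ⊆ T) (hQb : ∀ g ∈ Q, g.card = b) :
    (idealMons T (H ∪ Q) b).card = (idealMons T H b).card + Q.card ∧
    (up T (idealMons T H b)).card + ∑ j ∈ Finset.range Q.card, (T.card - H.card - j) ≤
      (up T (idealMons T (H ∪ Q) b)).card := by
  induction Q using Finset.induction_on with
  | empty => simp
  | insert g Q hgQ ih =>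
    have hsub : H ∪ Q ⊆ H ∪ insert g Q :=
      Finset.union_subset_union_right (Finset.subset_insert _ _)
    obtain ⟨ih1, ih2⟩ := ih (hanti.subset (Finset.coe_subset.2 hsub))
      (hHQ.mono_right (Finset.subset_insert _ _))
      (fun h hh => hQT h (Finset.mem_insert_of_mem hh))
      (fun h hh => hQb h (Finset.mem_insert_of_mem hh))
    have hgT := hQT g (Finset.mem_insert_self _ _)
    have hgb := hQb g (Finset.mem_insert_self _ _)
    have hgH : g ∉ H := Finset.disjoint_right.1 hHQ (Finset.mem_insert_self _ _)
    have hF : ∀ h ∈ H ∪ Q, ¬ h ⊆ g := fun h hh hhg => by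
      have : h = g := hanti.eq (Finset.mem_coe.2 (hsub hh))
        (Finset.mem_coe.2 (Finset.mem_union_right _ (Finset.mem_insert_self _ _))) hhg
      subst this
      exact (Finset.mem_union.1 hh).elim hgH hgQ
    have h1 := card_idealMons_insert hgT hF
    have h2 := card_up_insert_ge hgT hF
    have h3 := card_colonVars_le T (H ∪ Q) g
    have h4 := Finset.card_union_le H Q
    rw [hgb] at h1 h2
    rw [Finset.union_insert, Finset.card_insert_of_notMem hgQ, Finset.sum_range_succ]
    omega

/-- Products `w x_l x_i` with `l ∈ Z`, up to those that lie in `U`: if `w x_i y ∈ U` for `i` outside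
`R`, there are at most `|R| + (|R| - 1) + ⋯` of them. -/
theorem card_up_image_sdiff_le {T R Z : Finset σ} {w : σ →₀ ℕ} {U : Finset (σ →₀ ℕ)}
    (hZ : Z ⊆ R) (hZT : Z ⊆ T)
    (hU : ∀ i ∈ T, i ∉ R → ∀ l ∈ T, w + Finsupp.single l 1 + Finsupp.single i 1 ∈ U) :
    (up T (Z.image fun l => w + Finsupp.single l 1) \ U).card ≤
      ∑ j ∈ Finset.range Z.card, (R.card - j) := by
  induction Z using Finset.induction_on with
  | empty => simp [up]
  | insert z Z hz ih =>
    have ih := ih ((Finset.subset_insert _ _).trans hZ) ((Finset.subset_insert _ _).trans hZT)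
    have hsub : up T ((insert z Z).image fun l => w + Finsupp.single l 1) \ U ⊆
        (up T (Z.image fun l => w + Finsupp.single l 1) \ U) ∪
          (R \ Z).image fun i => w + Finsupp.single z 1 + Finsupp.single i 1 := by
      intro b hb
      obtain ⟨hb, hbU⟩ := Finset.mem_sdiff.1 hb
      obtain ⟨a, ha, i, hi, rfl⟩ := mem_up.1 hb
      obtain ⟨l, hl, rfl⟩ := Finset.mem_image.1 ha
      rcases Finset.mem_insert.1 hl with rfl | hl
      · by_cases hiZ : i ∈ Z
        · refine Finset.mem_union_left _ (Finset.mem_sdiff.2 ⟨?_, hbU⟩)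
          rw [add_right_comm]
          exact add_single_mem_up (Finset.mem_image_of_mem _ hiZ)
            (hZT (Finset.mem_insert_self _ _))
        · refine Finset.mem_union_right _ (Finset.mem_image.2
            ⟨i, Finset.mem_sdiff.2 ⟨?_, hiZ⟩, rfl⟩)
          by_contra hiR
          exact hbU (hU i hi hiR l (hZT (Finset.mem_insert_self _ _)))
      · exact Finset.mem_union_left _ (Finset.mem_sdiff.2
          ⟨add_single_mem_up (Finset.mem_image_of_mem _ hl) hi, hbU⟩)
    have h1 := (Finset.card_le_card hsub).trans (Finset.card_union_le _ _)
    have h2 : ((R \ Z).image fun i => w + Finsupp.single z 1 + Finsupp.single i 1).card ≤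
        (R \ Z).card := Finset.card_image_le
    rw [Finset.card_sdiff_of_subset ((Finset.subset_insert _ _).trans hZ)] at h2
    rw [Finset.card_insert_of_notMem hz, Finset.sum_range_succ]
    omega

/-- To a nested family `H` of generators of degree less than `b` one can adjoin `q` monomials of
degree `b`, if there are enough variables, such that the number of multiples does not exceed the
lower bound of `card_up_union_ge`: take the products of a fixed monomial, divisible by all the sets
`h \ {y h}` but by no `y h`, and `q` variables different from all `y h`. -/
theorem IsNestedBy.exists_card_up_le {T : Finset σ} {H : Finset (Finset σ)} {y : Finset σ → σ}
    (hH : IsNestedBy H y) (hHT : ∀ h ∈ H, h ⊆ T) {b q : ℕ} (hb : ∀ h ∈ H, h.card < b) (hb0 : 0 < b)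
    (hq : H.card + q ≤ T.card) :
    ∃ B ⊆ mons T b, B.card = (idealMons T H b).card + q ∧
      (up T B).card ≤ (up T (idealMons T H b)).card +
        ∑ j ∈ Finset.range q, (T.card - H.card - j) := by
  rcases Nat.eq_zero_or_pos q with rfl | hq0
  · exact ⟨_, idealMons_subset T H b, by simp, by simp⟩
  have hYT : H.image y ⊆ T := fun x hx => by
    obtain ⟨h, hh, rfl⟩ := Finset.mem_image.1 hx
    exact hHT h hh (hH.mem h hh)
  have hYcard : (H.image y).card = H.card := Finset.card_image_of_injOn hH.injOn
  set R := T \ H.image y with hR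
  have hRcard : R.card = T.card - H.card := by rw [Finset.card_sdiff_of_subset hYT, hYcard]
  obtain ⟨Z, hZR, hZq⟩ := Finset.exists_subset_card_eq (show q ≤ R.card by omega)
  obtain ⟨z, hz⟩ := Finset.card_pos.1 (hZq ▸ hq0)
  -- `C` is the largest of the sets `h \ {y h}`
  obtain ⟨C, hCR, hCb, hC⟩ : ∃ C ⊆ R, C.card ≤ b - 1 ∧ ∀ h ∈ H, h.erase (y h) ⊆ C := by
    rcases H.eq_empty_or_nonempty with rfl | hne
    · exact ⟨∅, by simp, by simp, by simp⟩
    · obtain ⟨g, hg, hmax⟩ := Finset.exists_max_image H Finset.card hne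
      refine ⟨g.erase (y g), fun x hx => Finset.mem_sdiff.2
        ⟨hHT g hg (Finset.mem_of_mem_erase hx), fun hxY => ?_⟩, ?_,
        fun h hh => hH.mono h hh g hg (hmax h hh)⟩
      · obtain ⟨h, hh, rfl⟩ := Finset.mem_image.1 hxY
        exact hH.notMem_erase hh hg hx
      · rw [Finset.card_erase_of_mem (hH.mem g hg)]
        have := hb g hg
        omega
  have hRT : R ⊆ T := Finset.sdiff_subset
  have hZT := hZR.trans hRT
  set w := sqfreeExponent C + Finsupp.single z (b - 1 - C.card) with hw
  have hwm : w ∈ mons R (b - 1) := by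
    have := add_single_mem_mons (j := b - 1 - C.card) (sqfreeExponent_mem_mons hCR) (hZR hz)
    rwa [Nat.add_sub_cancel' hCb] at this
  have hwl : ∀ {S : Finset σ}, R ⊆ S → ∀ l ∈ S, w + Finsupp.single l 1 ∈ mons S b :=
    fun hS l hl => by
      have := add_single_mem_mons (j := 1) (mons_mono hS _ hwm) hl
      rwa [Nat.sub_add_cancel hb0] at this
  -- the products of `w` and a variable `y h` belong to the ideal generated by `H`
  have hwy : ∀ i ∈ T, i ∉ R → w + Finsupp.single i 1 ∈ idealMons T H b := by
    intro i hi hiR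
    have hiY : i ∈ H.image y := by
      by_contra h
      exact hiR (Finset.mem_sdiff.2 ⟨hi, h⟩)
    obtain ⟨h, hh, rfl⟩ := Finset.mem_image.1 hiY
    refine mem_idealMons.2 ⟨hwl hRT _ hi, h, hh, fun k hk => ?_⟩
    by_cases hky : k = y h
    · simp [hky]
    · have := hC h hh (Finset.mem_erase.2 ⟨hky, hk⟩)
      simp [hw, sqfreeExponent_apply, this]
  have hinj : Function.Injective fun l : σ => w + Finsupp.single l 1 :=
    (add_right_injective _).comp (Finsupp.single_left_injective one_ne_zero)
  refine ⟨idealMons T H b ∪ Z.image fun l => w + Finsupp.single l 1,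
    Finset.union_subset (idealMons_subset _ _ _) fun a ha => ?_, ?_, ?_⟩
  · obtain ⟨l, hl, rfl⟩ := Finset.mem_image.1 ha
    exact hwl hRT l (hZT hl)
  · rw [Finset.card_union_of_disjoint, Finset.card_image_of_injective _ hinj, hZq]
    rw [Finset.disjoint_right]
    intro a ha ha'
    obtain ⟨l, hl, rfl⟩ := Finset.mem_image.1 ha
    obtain ⟨_, h, hh, hsub⟩ := mem_idealMons.1 ha'
    have h1 := (mem_mons.1 (hwl subset_rfl l (hZR hl))).2 (hsub (hH.mem h hh))
    exact (Finset.mem_sdiff.1 h1).2 (Finset.mem_image_of_mem y hh)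
  · have h1 := card_up_image_sdiff_le (U := up T (idealMons T H b)) (w := w) hZR hZT
      fun i hi hiR l hl => by
        rw [add_right_comm]
        exact add_single_mem_up (hwy i hi hiR) hl
    rw [hZq, hRcard] at h1
    rw [up_union, ← Finset.union_sdiff_self_eq_union]
    exact (Finset.card_union_le _ _).trans (Nat.add_le_add_left h1 _)

/-- In a Gotzmann squarefree monomial ideal with at most as many generators as variables, if the
generators of degree less than `|g|` are nested, each generator of degree at most `|g|` other than
`g` contributes a variable of its own to the colon ideal by `g`. -/
theorem IsGotzmannFamily.card_colonVars {T : Finset σ} {G : Finset (Finset σ)}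
    (hG : IsGotzmannFamily T G) (hanti : IsAntichain (· ⊆ ·) (G : Set (Finset σ)))
    (hT : ∀ g ∈ G, g ⊆ T) (hcard : G.card ≤ T.card) {g : Finset σ} (hg : g ∈ G)
    (hg0 : g.Nonempty) (hH : IsNested (G.filter fun h => h.card < g.card)) :
    ((G.filter fun h => h.card ≤ g.card).erase g).card ≤
      (colonVars T ((G.filter fun h => h.card ≤ g.card).erase g) g).card := by
  set b := g.card with hb
  set H := G.filter fun h => h.card < b with hHdef
  set Q := (G.filter fun h => h.card = b).erase g with hQdef
  have hgQ : g ∉ Q := Finset.notMem_erase _ _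
  have hHQ : (G.filter fun h => h.card ≤ b).erase g = H ∪ Q := by
    ext h
    simp only [hHdef, hQdef, Finset.mem_erase, Finset.mem_filter, Finset.mem_union]
    constructor
    · rintro ⟨h1, h2, h3⟩
      rcases h3.lt_or_eq with h4 | h4
      · exact Or.inl ⟨h2, h4⟩
      · exact Or.inr ⟨h1, h2, h4⟩
    · rintro (⟨h1, h2⟩ | ⟨h1, h2, h3⟩)
      · refine ⟨?_, h1, h2.le⟩
        rintro rfl
        exact lt_irrefl _ h2
      · exact ⟨h1, h2, h3.le⟩
  have hHG : H ⊆ G := Finset.filter_subset _ _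
  have hQG : Q ⊆ G := (Finset.erase_subset _ _).trans (Finset.filter_subset _ _)
  have hdisj : Disjoint H Q := by
    rw [Finset.disjoint_left]
    intro h h1 h2
    have h3 := (Finset.mem_filter.1 h1).2
    have h4 := (Finset.mem_filter.1 (Finset.mem_of_mem_erase h2)).2
    omega
  have hgH : g ∉ H := fun h => lt_irrefl _ (Finset.mem_filter.1 h).2
  have hgHQ : g ∉ H ∪ Q := fun h => (Finset.mem_union.1 h).elim hgH hgQ
  rw [hHQ]
  have hHQG : H ∪ Q ⊆ G := Finset.union_subset hHG hQG
  -- in degree `b`, the ideal is generated by `insert g (H ∪ Q)`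
  have hI : idealMons T G b = idealMons T (insert g (H ∪ Q)) b := by
    ext a
    rw [mem_idealMons, mem_idealMons]
    refine and_congr_right fun ha => ⟨?_, ?_⟩
    · rintro ⟨h, hh, hha⟩
      refine ⟨h, ?_, hha⟩
      by_cases hhg : h = g
      · exact hhg ▸ Finset.mem_insert_self _ _
      · refine Finset.mem_insert_of_mem ?_
        rw [← hHQ, Finset.mem_erase, Finset.mem_filter]
        refine ⟨hhg, hh, ?_⟩
        have h1 : sqfreeExponent h ≤ a := sqfreeExponent_le_iff.2 hha
        have h2 := Finsupp.degree_mono h1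
        rwa [degree_sqfreeExponent, (mem_mons.1 ha).1] at h2
    · rintro ⟨h, hh, hha⟩
      exact ⟨h, Finset.insert_subset hg hHQG hh, hha⟩
  have hF : ∀ h ∈ H ∪ Q, ¬ h ⊆ g := fun h hh hhg =>
    hgHQ (hanti.eq (hHQG hh) hg hhg ▸ hh)
  obtain ⟨h1, h2⟩ := card_up_union_ge (T := T) (H := H) (Q := Q) (b := b)
    (hanti.subset (Finset.coe_subset.2 hHQG)) hdisj (fun h hh => hT h (hQG hh))
    fun h hh => (Finset.mem_filter.1 (Finset.mem_of_mem_erase hh)).2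
  have h3 := card_idealMons_insert (hT g hg) hF
  have h4 := card_up_insert_ge (hT g hg) hF
  rw [← hb, ← hI] at h3 h4
  have hcHQ : (H ∪ Q).card = H.card + Q.card := Finset.card_union_of_disjoint hdisj
  have hlt : (H ∪ Q).card < G.card := Finset.card_lt_card
    ⟨hHQG, fun h => hgHQ (h hg)⟩
  have hb0 : 0 < b := Finset.card_pos.2 hg0
  obtain ⟨B, hB, hBcard, hBup⟩ : ∃ B ⊆ mons T b, B.card = (idealMons T H b).card + (Q.card + 1) ∧
      (up T B).card ≤ (up T (idealMons T H b)).card +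
        ∑ j ∈ Finset.range (Q.card + 1), (T.card - H.card - j) := by
    rcases hH with hH | ⟨y, hy⟩
    · exact IsNestedBy.exists_card_up_le (y := fun _ => hg0.choose)
        (by rw [hH]; exact ⟨by simp, by simp, by simp⟩)
        (fun h hh => hT h (hHG hh)) (fun h hh => (Finset.mem_filter.1 hh).2) hb0 (by omega)
    · exact hy.exists_card_up_le
        (fun h hh => hT h (hHG hh)) (fun h hh => (Finset.mem_filter.1 hh).2) hb0 (by omega)
  have h5 := (hG b).2 B hB (by omega)
  rw [Finset.sum_range_succ] at hBup
  omega

theorem IsGotzmannFamily.isNested_of_card_le {T : Finset σ} {G : Finset (Finset σ)}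
    (hG : IsGotzmannFamily T G) (hanti : IsAntichain (· ⊆ ·) (G : Set (Finset σ)))
    (h0 : ∅ ∉ G) (hT : ∀ g ∈ G, g ⊆ T) (hcard : G.card ≤ T.card) : IsNested G := by
  have key : ∀ b, HasSingletonDiffs (G.filter fun h => h.card < b) := by
    intro b
    induction b with
    | zero => simp [HasSingletonDiffs]
    | succ b ih =>
      intro g hg
      obtain ⟨hgG, hgb⟩ := Finset.mem_filter.1 hg
      have hH : IsNested (G.filter fun h => h.card < g.card) := by
        refine HasSingletonDiffs.isNested (fun g' hg' h hh hne hc => ?_)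
          (hanti.subset (Finset.coe_subset.2 (Finset.filter_subset _ _)))
          fun h => h0 (Finset.mem_filter.1 h).1
        have hsub : G.filter (fun h => h.card < g.card) ⊆ G.filter fun h => h.card < b :=
          fun h hh => Finset.mem_filter.2 ⟨(Finset.mem_filter.1 hh).1, by
            have := (Finset.mem_filter.1 hh).2
            omega⟩
        obtain ⟨h1, h2⟩ := ih g' (hsub hg') h (hsub hh) hne hc
        exact ⟨h1, fun h' hh' => h2 h' (hsub hh')⟩
      obtain ⟨h1, h2⟩ := singleton_diffs_of_card_colonVars (hG.card_colonVars hanti hT hcard hgG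
        (Finset.nonempty_iff_ne_empty.2 fun h => h0 (h ▸ hgG)) hH)
      have hmem : ∀ h ∈ G.filter fun h => h.card < b + 1, h ≠ g → h.card ≤ g.card →
          h ∈ (G.filter fun h => h.card ≤ g.card).erase g := fun h hh hne hc =>
        Finset.mem_erase.2 ⟨hne, Finset.mem_filter.2 ⟨(Finset.mem_filter.1 hh).1, hc⟩⟩
      exact fun h hh hne hc => ⟨h1 h (hmem h hh hne hc),
        fun h' hh' hne' hc' he => h2 (hmem h hh hne hc) (hmem h' hh' hne' hc') he⟩
  have hfil : G.filter (fun h => h.card < T.card + 1) = G := Finset.filter_true_of_mem fun g hg =>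
    Nat.lt_succ_of_le (Finset.card_le_card (hT g hg))
  exact (hfil ▸ key (T.card + 1)).isNested hanti h0

/-- A squarefree monomial ideal has at most as many generators as there are variables, if the ideals
obtained by setting a variable to zero are nested. Since the generators avoiding `x`
satisfy `N ≤ n - |g|`, their weights `1 / (n - |g|)` add up to at most `1`; the sum over all `x` of
these weights is the number of generators. -/
theorem card_le_of_isNested_filter {T : Finset σ} {G : Finset (Finset σ)}
    (hanti : IsAntichain (· ⊆ ·) (G : Set (Finset σ))) (h0 : ∅ ∉ G) (hT : ∀ g ∈ G, g ⊆ T)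
    (h : ∀ x ∈ T, IsNested (G.filter fun g => x ∉ g)) : G.card ≤ T.card := by
  by_cases hTG : T ∈ G
  · have : G = {T} := Finset.eq_singleton_iff_unique_mem.2
      ⟨hTG, fun g hg => hanti.eq hg hTG (hT g hg)⟩
    rw [this, Finset.card_singleton]
    exact Finset.card_pos.2 (Finset.nonempty_iff_ne_empty.2 fun h => h0 (h ▸ hTG))
  have hlt : ∀ g ∈ G, g.card < T.card := fun g hg =>
    Finset.card_lt_card ((hT g hg).ssubset_of_ne fun h => hTG (h ▸ hg))
  have h1 : ∀ x ∈ T, ∑ g ∈ G.filter (fun g => x ∉ g), (1 : ℚ) / (T.card - g.card) ≤ 1 := by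
    intro x hx
    rcases h x hx with he | ⟨y, hy⟩
    · simp [he]
    rcases (G.filter fun g => x ∉ g).eq_empty_or_nonempty with he | hne
    · simp [he]
    have hN : (0 : ℚ) < (G.filter fun g => x ∉ g).card := by
      exact_mod_cast Finset.card_pos.2 hne
    calc ∑ g ∈ G.filter (fun g => x ∉ g), (1 : ℚ) / (T.card - g.card)
        ≤ ∑ g ∈ G.filter (fun g => x ∉ g), (1 : ℚ) / (G.filter fun g => x ∉ g).card := by
          refine Finset.sum_le_sum fun g hg => one_div_le_one_div_of_le hN ?_
          have h2 := hy.card_add_card_le (T := T.erase x) (fun g hg => Finset.subset_erase.2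
            ⟨hT g (Finset.mem_filter.1 hg).1, (Finset.mem_filter.1 hg).2⟩) hg
          rw [Finset.card_erase_of_mem hx] at h2
          have h3 := Finset.card_pos.2 ⟨x, hx⟩
          have h4 : (G.filter fun g => x ∉ g).card + g.card ≤ T.card := by omega
          have : ((G.filter fun g => x ∉ g).card : ℚ) + g.card ≤ T.card := by exact_mod_cast h4
          linarith
      _ = 1 := by
          rw [Finset.sum_const, nsmul_eq_mul, mul_one_div, div_self hN.ne']
  have h2 : ∑ x ∈ T, ∑ g ∈ G.filter (fun g => x ∉ g), (1 : ℚ) / (T.card - g.card) = G.card := by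
    simp_rw [Finset.sum_filter]
    rw [Finset.sum_comm, show (G.card : ℚ) = ∑ _g ∈ G, 1 by simp]
    refine Finset.sum_congr rfl fun g hg => ?_
    have h3 : (g.card : ℚ) < T.card := by exact_mod_cast hlt g hg
    rw [← Finset.sum_filter, Finset.sum_const, nsmul_eq_mul,
      Finset.filter_notMem_eq_sdiff, Finset.card_sdiff_of_subset (hT g hg),
      Nat.cast_sub (hlt g hg).le, mul_one_div, div_self (by linarith)]
  have h3 : (G.card : ℚ) ≤ T.card := by
    rw [← h2]
    simpa using Finset.sum_le_sum h1
  exact_mod_cast h3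

/-- The generators of a Gotzmann squarefree monomial ideal form a nested family. -/
theorem IsGotzmannFamily.isNested {T : Finset σ} {G : Finset (Finset σ)}
    (hG : IsGotzmannFamily T G) (hanti : IsAntichain (· ⊆ ·) (G : Set (Finset σ)))
    (h0 : ∅ ∉ G) (hT : ∀ g ∈ G, g ⊆ T) : IsNested G := by
  induction hn : T.card generalizing T G with
  | zero =>
    refine Or.inl (Finset.eq_empty_of_forall_notMem fun g hg => h0 ?_)
    have := hT g hg
    rw [Finset.card_eq_zero.1 hn, Finset.subset_empty] at this
    exact this ▸ hg
  | succ n ih =>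
    refine hG.isNested_of_card_le hanti h0 hT (card_le_of_isNested_filter hanti h0 hT fun x hx => ?_)
    refine ih (hG.filter_notMem hx)
      (hanti.subset (Finset.coe_subset.2 (Finset.filter_subset _ _)))
      (fun h => h0 (Finset.mem_filter.1 h).1) (fun g hg => Finset.subset_erase.2
        ⟨hT g (Finset.mem_filter.1 hg).1, (Finset.mem_filter.1 hg).2⟩) ?_
    rw [Finset.card_erase_of_mem hx, hn, Nat.add_sub_cancel]

end Classification

/-! ### Passage to polynomials -/

section Polynomials

variable {k : Type*} [Field k] {n : ℕ}

theorem finrank_restrictSupport (A : Finset (Fin n →₀ ℕ)) :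
    Module.finrank k (restrictSupport k (A : Set (Fin n →₀ ℕ))) = A.card := by
  rw [Module.finrank_eq_nat_card_basis (basisRestrictSupport k (A : Set (Fin n →₀ ℕ)))]
  simp

theorem homogeneousSubmodule_one_mul_restrictSupport (A : Finset (Fin n →₀ ℕ)) :
    homogeneousSubmodule (Fin n) k 1 * restrictSupport k (A : Set (Fin n →₀ ℕ)) =
      restrictSupport k (up Finset.univ A : Set (Fin n →₀ ℕ)) := by
  have h : homogeneousSubmodule (Fin n) k 1 =
      restrictSupport k (Set.range fun i : Fin n => Finsupp.single i 1) := by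
    rw [homogeneousSubmodule_one_eq_span_X, restrictSupport_eq_span, ← Set.range_comp]
    rfl
  rw [h, ← restrictSupport_add]
  congr 1
  ext a
  simp only [Set.mem_add, Set.mem_range, exists_exists_eq_and, Finset.mem_coe, mem_up,
    Finset.mem_univ, true_and]
  constructor
  · rintro ⟨i, b, hb, rfl⟩
    exact ⟨b, hb, i, add_comm _ _⟩
  · rintro ⟨b, hb, i, rfl⟩
    exact ⟨i, b, hb, add_comm _ _⟩

/-- The leading monomials, for the lexicographic order, of the forms of degree `d` in `V`. -/
noncomputable def leadingExponents (V : Submodule k (MvPolynomial (Fin n) k)) (d : ℕ) :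
    Finset (Fin n →₀ ℕ) := by
  classical
  exact (mons Finset.univ d).filter fun a => ∃ f ∈ V, f ≠ 0 ∧ MonomialOrder.lex.degree f = a

theorem mem_leadingExponents {V : Submodule k (MvPolynomial (Fin n) k)} {d : ℕ}
    (hV : V ≤ homogeneousSubmodule (Fin n) k d) {a : Fin n →₀ ℕ} :
    a ∈ leadingExponents V d ↔ ∃ f ∈ V, f ≠ 0 ∧ MonomialOrder.lex.degree f = a := by
  classical
  rw [leadingExponents, Finset.mem_filter, and_iff_right_iff_imp]
  rintro ⟨f, hf, hf0, rfl⟩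
  refine mem_mons.2 ⟨?_, Finset.subset_univ _⟩
  by_contra h
  exact MonomialOrder.lex.coeff_degree_ne_zero_iff.2 hf0 ((hV hf).coeff_eq_zero h)

theorem leadingExponents_subset (V : Submodule k (MvPolynomial (Fin n) k)) (d : ℕ) :
    leadingExponents V d ⊆ mons Finset.univ d := by
  classical
  exact Finset.filter_subset _ _

/-- A form in `V` is determined by its coefficients at the leading monomials of `V`. -/
theorem finrank_le_card_leadingExponents {V : Submodule k (MvPolynomial (Fin n) k)} {d : ℕ}
    (hV : V ≤ homogeneousSubmodule (Fin n) k d) :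
    Module.finrank k V ≤ (leadingExponents V d).card := by
  let φ : V →ₗ[k] (leadingExponents V d → k) :=
    LinearMap.pi fun a => (lcoeff k (a : Fin n →₀ ℕ)).comp V.subtype
  have hφ : Function.Injective φ := by
    rw [← LinearMap.ker_eq_bot, LinearMap.ker_eq_bot']
    rintro ⟨f, hf⟩ h
    by_contra h0
    have hf0 : f ≠ 0 := fun h => h0 (by simp [h])
    exact MonomialOrder.lex.coeff_degree_ne_zero_iff.2 hf0
      (congrFun h ⟨_, (mem_leadingExponents hV).2 ⟨f, hf, hf0, rfl⟩⟩)
  have := LinearMap.finrank_le_finrank_of_injective hφ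
  simpa using this

/-- Forms with distinct leading monomials are linearly independent. -/
theorem card_leadingExponents_le_finrank {V : Submodule k (MvPolynomial (Fin n) k)} {d : ℕ}
    (hV : V ≤ homogeneousSubmodule (Fin n) k d) :
    (leadingExponents V d).card ≤ Module.finrank k V := by
  classical
  have hfg := homogeneousSubmodule_fg (Fin n) k d
  have : Module.Finite k (homogeneousSubmodule (Fin n) k d) := Module.Finite.iff_fg.2 hfg
  have : Module.Finite k V := Submodule.finiteDimensional_of_le hV
  have h : ∀ a : leadingExponents V d, ∃ f ∈ V, f ≠ 0 ∧ MonomialOrder.lex.degree f = a :=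
    fun a => (mem_leadingExponents hV).1 a.2
  choose f hfV hf0 hfa using h
  have hli : LinearIndependent k fun a => (⟨f a, hfV a⟩ : V) := by
    refine LinearIndependent.of_comp V.subtype ?_
    rw [linearIndependent_iff']
    intro s c hc
    by_contra! hne
    obtain ⟨i, hi, hci⟩ := hne
    obtain ⟨a, ha, hmax⟩ := Finset.exists_max_image (s.filter fun a => c a ≠ 0)
      (fun a => toLex (a : Fin n →₀ ℕ)) ⟨i, Finset.mem_filter.2 ⟨hi, hci⟩⟩
    obtain ⟨has, hca⟩ := Finset.mem_filter.1 ha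
    have h1 := congrArg (coeff (a : Fin n →₀ ℕ)) hc
    rw [coeff_sum, Finset.sum_eq_single_of_mem a has] at h1
    · simp only [Function.comp_apply, Submodule.subtype_apply, coeff_smul, coeff_zero,
        smul_eq_mul, mul_eq_zero, hca, false_or] at h1
      exact MonomialOrder.lex.coeff_degree_ne_zero_iff.2 (hf0 a) (by rw [hfa a, h1])
    · intro b hb hba
      by_cases hcb : c b = 0
      · simp [hcb]
      · have h2 : toLex (b : Fin n →₀ ℕ) < toLex (a : Fin n →₀ ℕ) :=
          lt_of_le_of_ne (hmax b (Finset.mem_filter.2 ⟨hb, hcb⟩))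
            fun h => hba (Subtype.ext (toLex.injective h))
        have h3 : coeff (a : Fin n →₀ ℕ) (f b) = 0 := by
          refine MonomialOrder.lex.coeff_eq_zero_of_lt (f := f b) ?_
          rw [hfa b]
          exact MonomialOrder.lex_lt_iff.2 h2
        simp [h3]
  simpa using hli.fintype_card_le_finrank

/-- Products of linear forms and forms in `V` have at least the products of variables and leading
monomials of `V` as leading monomials. -/
theorem card_up_leadingExponents_le_finrank {V : Submodule k (MvPolynomial (Fin n) k)} {d : ℕ}
    (hV : V ≤ homogeneousSubmodule (Fin n) k d) :
    (up Finset.univ (leadingExponents V d)).card ≤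
      Module.finrank k ↥(homogeneousSubmodule (Fin n) k 1 * V) := by
  have hW : homogeneousSubmodule (Fin n) k 1 * V ≤ homogeneousSubmodule (Fin n) k (d + 1) := by
    rw [add_comm]
    exact (mul_le_mul_right hV _).trans (homogeneousSubmodule_mul 1 d)
  refine (Finset.card_le_card fun b hb => ?_).trans (card_leadingExponents_le_finrank hW)
  obtain ⟨a, ha, i, _, rfl⟩ := mem_up.1 hb
  obtain ⟨f, hf, hf0, rfl⟩ := (mem_leadingExponents hV).1 ha
  refine (mem_leadingExponents hW).2 ⟨X i * f,
    Submodule.mul_mem_mul (isHomogeneous_X k i) hf, mul_ne_zero (X_ne_zero i) hf0, ?_⟩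
  rw [MonomialOrder.lex.degree_mul (X_ne_zero i) hf0, MonomialOrder.degree_X, add_comm]

theorem sqfreeMonomial_eq_monomial (g : Finset (Fin n)) :
    sqfreeMonomial k g = monomial (sqfreeExponent g) 1 := by
  rw [sqfreeMonomial, monomial_eq, Finsupp.prod, support_sqfreeExponent, C_1, one_mul]
  exact Finset.prod_congr rfl fun i hi => by rw [sqfreeExponent_apply, if_pos hi, pow_one]

theorem mem_span_sqfreeMonomial {G : Set (Finset (Fin n))} {f : MvPolynomial (Fin n) k} :
    f ∈ Ideal.span (sqfreeMonomial k '' G) ↔ ∀ a ∈ f.support, ∃ g ∈ G, g ⊆ a.support := by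
  have h : sqfreeMonomial k '' G = (fun a => monomial a (1 : k)) '' (sqfreeExponent '' G) := by
    rw [Set.image_image]
    exact Set.image_congr fun g _ => sqfreeMonomial_eq_monomial g
  rw [h, mem_ideal_span_monomial_image]
  simp [sqfreeExponent_le_iff]

theorem mem_homogeneousSubmodule_iff_support {d : ℕ} {f : MvPolynomial (Fin n) k} :
    f ∈ homogeneousSubmodule (Fin n) k d ↔ ∀ a ∈ f.support, a ∈ mons Finset.univ d := by
  rw [homogeneousSubmodule_eq_finsupp_supported]
  simp only [mem_mons, Finset.subset_univ, and_true]
  rfl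

theorem idealDegree_span_sqfreeMonomial (G : Finset (Finset (Fin n))) (d : ℕ) :
    idealDegree (Ideal.span (sqfreeMonomial k '' (G : Set (Finset (Fin n))))) d =
      restrictSupport k (idealMons Finset.univ G d : Set (Fin n →₀ ℕ)) := by
  ext f
  rw [idealDegree, Submodule.mem_inf, Submodule.restrictScalars_mem, mem_span_sqfreeMonomial,
    mem_homogeneousSubmodule_iff_support, mem_restrictSupport_iff]
  simp only [Set.subset_def, Finset.mem_coe, mem_idealMons]
  exact ⟨fun h a ha => ⟨h.2 a ha, h.1 a ha⟩, fun h => ⟨fun a ha => (h a ha).2, fun a ha => (h a ha).1⟩⟩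

theorem idealDegree_span_monomial {B : Finset (Fin n →₀ ℕ)} {d : ℕ}
    (hB : B ⊆ mons Finset.univ d) :
    idealDegree (Ideal.span ((fun a => monomial a (1 : k)) '' (B : Set (Fin n →₀ ℕ)))) d =
      restrictSupport k (B : Set (Fin n →₀ ℕ)) := by
  ext f
  rw [idealDegree, Submodule.mem_inf, Submodule.restrictScalars_mem, mem_ideal_span_monomial_image,
    mem_homogeneousSubmodule_iff_support, mem_restrictSupport_iff]
  simp only [Set.subset_def, Finset.mem_coe]
  constructor
  · rintro ⟨h1, h2⟩ a ha
    obtain ⟨b, hb, hba⟩ := h1 a ha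
    obtain ⟨c, rfl⟩ := exists_add_of_le hba
    have h3 := (mem_mons.1 (h2 _ ha)).1
    rw [map_add, (mem_mons.1 (hB hb)).1] at h3
    rwa [(Finsupp.degree_eq_zero_iff c).1 (by omega), add_zero]
  · exact fun h => ⟨fun a ha => ⟨a, h a ha, le_rfl⟩, fun a ha => hB (h a ha)⟩

/-- For squarefree monomial ideals, the Gotzmann property can be tested on monomials. -/
theorem isGotzmannIdeal_span_sqfreeMonomial_iff (G : Finset (Finset (Fin n))) :
    IsGotzmannIdeal (Ideal.span (sqfreeMonomial k '' (G : Set (Finset (Fin n))))) ↔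
      IsGotzmannFamily Finset.univ G := by
  constructor
  · intro h d
    refine ⟨idealMons_subset _ _ _, fun B hB hBG => ?_⟩
    have h1 := h d (Ideal.span ((fun a => monomial a (1 : k)) '' (B : Set (Fin n →₀ ℕ))))
      (Ideal.homogeneous_span _ _ (by
        rintro _ ⟨a, ha, rfl⟩
        exact ⟨d, isHomogeneous_monomial _ (mem_mons.1 (hB ha)).1⟩))
    rw [idealDegree_span_sqfreeMonomial, idealDegree_span_monomial hB,
      homogeneousSubmodule_one_mul_restrictSupport, homogeneousSubmodule_one_mul_restrictSupport,
      finrank_restrictSupport, finrank_restrictSupport, finrank_restrictSupport,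
      finrank_restrictSupport] at h1
    exact h1 hBG.symm
  · intro h d J _ hJ
    have hV : idealDegree J d ≤ homogeneousSubmodule (Fin n) k d := inf_le_right
    rw [idealDegree_span_sqfreeMonomial, finrank_restrictSupport] at hJ
    rw [idealDegree_span_sqfreeMonomial, homogeneousSubmodule_one_mul_restrictSupport,
      finrank_restrictSupport]
    exact ((h d).card_up_le (leadingExponents_subset _ d)
      (hJ.le.trans (finrank_le_card_leadingExponents hV))).trans
      (card_up_leadingExponents_le_finrank hV)

/-- The minimal generators of a squarefree monomial ideal, as a family of sets of variables. -/
theorem IsSquarefreeMonomialIdeal.exists_family {I : Ideal (MvPolynomial (Fin n) k)}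
    (hI : IsSquarefreeMonomialIdeal I) (hne : I ≠ ⊤) : ∃ G : Finset (Finset (Fin n)),
      IsAntichain (· ⊆ ·) (G : Set (Finset (Fin n))) ∧ ∅ ∉ G ∧
      I = Ideal.span (sqfreeMonomial k '' (G : Set (Finset (Fin n)))) ∧
      monomialGens I = sqfreeExponent '' (G : Set (Finset (Fin n))) := by
  classical
  obtain ⟨⟨A, hA⟩, hsq⟩ := hI
  have hmem : ∀ f, f ∈ I ↔ ∀ a ∈ f.support, monomial a (1 : k) ∈ I := by
    intro f
    rw [hA, mem_ideal_span_monomial_image]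
    refine forall₂_congr fun a _ => ?_
    rw [mem_ideal_span_monomial_image]
    simp
  set G : Finset (Finset (Fin n)) :=
    Finset.univ.filter fun g => sqfreeExponent g ∈ monomialGens I with hG
  have hgens : monomialGens I = sqfreeExponent '' (G : Set (Finset (Fin n))) := by
    ext a
    constructor
    · intro ha
      have : a = sqfreeExponent a.support := by
        ext i
        rw [sqfreeExponent_apply]
        have := hsq a ha i
        split_ifs with hi
        · have := Finsupp.mem_support_iff.1 hi
          omega
        · exact Finsupp.notMem_support_iff.1 hi
      refine ⟨a.support, ?_, this.symm⟩
      rw [Finset.mem_coe, hG, Finset.mem_filter, ← this]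
      exact ⟨Finset.mem_univ _, ha⟩
    · rintro ⟨g, hg, rfl⟩
      exact (Finset.mem_filter.1 (Finset.mem_coe.1 hg)).2
  have hGmem : ∀ g ∈ G, Minimal (fun b => monomial b (1 : k) ∈ I) (sqfreeExponent g) :=
    fun g hg => (Finset.mem_filter.1 hg).2
  refine ⟨G, ?_, ?_, ?_, hgens⟩
  · intro g hg h hh hgh hsub
    have h1 : sqfreeExponent g ≤ sqfreeExponent h :=
      sqfreeExponent_le_iff.2 (by rwa [support_sqfreeExponent])
    have h2 := (hGmem h hh).2 (hGmem g hg).1 h1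
    rw [sqfreeExponent_le_iff, support_sqfreeExponent] at h2
    exact hgh (Finset.Subset.antisymm hsub h2)
  · intro h
    have h1 : monomial (sqfreeExponent ∅) (1 : k) ∈ I := (hGmem _ h).1
    rw [← sqfreeMonomial_eq_monomial, sqfreeMonomial, Finset.prod_empty] at h1
    exact hne ((Ideal.eq_top_iff_one I).2 h1)
  · ext f
    rw [hmem, mem_span_sqfreeMonomial]
    refine forall₂_congr fun a _ => ⟨fun ha => ?_, fun ⟨g, hg, hga⟩ => ?_⟩
    · obtain ⟨b, hba, hb⟩ := exists_minimal_le_of_wellFoundedLT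
        (fun b => monomial b (1 : k) ∈ I) a ha
      obtain ⟨g, hg, rfl⟩ : b ∈ sqfreeExponent '' (G : Set (Finset (Fin n))) := hgens ▸ hb
      exact ⟨g, hg, sqfreeExponent_le_iff.1 hba⟩
    · obtain ⟨c, rfl⟩ := exists_add_of_le (sqfreeExponent_le_iff.2 hga)
      have := I.mul_mem_right (monomial c 1) (hGmem g hg).1
      rwa [monomial_mul, one_mul] at this

end Polynomials

/-! ### Nested forms and supernovas -/

section NestedForms

theorem isNested_of_cores {σ : Type*} [LinearOrder σ] {G : Finset (Finset σ)}
    (hanti : IsAntichain (· ⊆ ·) (G : Set (Finset σ))) (C : Finset σ → Finset σ)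
    (hC : ∀ g ∈ G, ∃ y ∉ C g, insert y (C g) = g)
    (hmono : ∀ g ∈ G, ∀ h ∈ G, g.card ≤ h.card → C g ⊆ C h) : IsNested G := by
  rcases G.eq_empty_or_nonempty with he | ⟨g₀, hg₀⟩
  · exact Or.inl he
  have h : ∀ g, ∃ y, g ∈ G → y ∉ C g ∧ insert y (C g) = g := fun g => by
    by_cases hg : g ∈ G
    · obtain ⟨y, hy⟩ := hC g hg
      exact ⟨y, fun _ => hy⟩
    · exact ⟨(hC g₀ hg₀).choose, fun h => absurd h hg⟩
  choose y hy using h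
  have hCy : ∀ g ∈ G, g.erase (y g) = C g := fun g hg => by
    nth_rewrite 1 [← (hy g hg).2]
    exact Finset.erase_insert (hy g hg).1
  refine Or.inr ⟨y, hanti, fun g hg => ?_, fun g hg h hh hc => ?_⟩
  · have := Finset.mem_insert_self (y g) (C g)
    rwa [(hy g hg).2] at this
  · rw [hCy g hg, hCy h hh]
    exact hmono g hg h hh hc

/-- A chain of subsets of `E` can be refined to a chain with one set of each cardinality. -/
theorem exists_flag {σ : Type*} [DecidableEq σ] (E : Finset σ) (S : Finset (Finset σ))
    (hSE : ∀ C ∈ S, C ⊆ E) (hS : ∀ C ∈ S, ∀ D ∈ S, C.card ≤ D.card → C ⊆ D) :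
    ∃ F : ℕ → Finset σ, (∀ i ≤ E.card, (F i).card = i ∧ F i ⊆ E) ∧
      (∀ i j, i ≤ j → j ≤ E.card → F i ⊆ F j) ∧ ∀ C ∈ S, F C.card = C := by
  induction hn : E.card generalizing E S with
  | zero =>
    have hE := Finset.card_eq_zero.1 hn
    refine ⟨fun _ => ∅, fun i hi => ⟨by simp; omega, by simp⟩, fun _ _ _ _ => subset_rfl,
      fun C hC => ?_⟩
    exact (Finset.subset_empty.1 (hE ▸ hSE C hC)).symm
  | succ n ih =>
    -- the proper subsets of `E` in the chain all avoid some element of `E`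
    obtain ⟨x, hxE, hx⟩ : ∃ x ∈ E, ∀ C ∈ S.erase E, x ∉ C := by
      rcases (S.erase E).eq_empty_or_nonempty with he | hne
      · obtain ⟨x, hx⟩ := Finset.card_pos.1 (by omega : 0 < E.card)
        exact ⟨x, hx, by simp [he]⟩
      · obtain ⟨D, hD, hmax⟩ := Finset.exists_max_image _ Finset.card hne
        obtain ⟨hDE, hDS⟩ := Finset.mem_erase.1 hD
        obtain ⟨x, hxE, hxD⟩ := Finset.not_subset.1
          fun h => hDE ((hSE D hDS).antisymm h)
        exact ⟨x, hxE, fun C hC hxC =>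
          hxD (hS C (Finset.mem_of_mem_erase hC) D hDS (hmax C hC) hxC)⟩
    have hcard : (E.erase x).card = n := by
      rw [Finset.card_erase_of_mem hxE, hn, Nat.add_sub_cancel]
    obtain ⟨F, hF1, hF2, hF3⟩ := ih (E.erase x) (S.erase E)
      (fun C hC => Finset.subset_erase.2 ⟨hSE C (Finset.mem_of_mem_erase hC), hx C hC⟩)
      (fun C hC D hD => hS C (Finset.mem_of_mem_erase hC) D (Finset.mem_of_mem_erase hD)) hcard
    refine ⟨fun i => if i ≤ n then F i else E, fun i hi => ?_, fun i j hij hj => ?_,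
      fun C hC => ?_⟩
    · dsimp only
      split_ifs with h
      · exact ⟨(hF1 i h).1, (hF1 i h).2.trans (Finset.erase_subset _ _)⟩
      · exact ⟨by omega, subset_rfl⟩
    · dsimp only
      split_ifs with h1 h2 h2
      · exact hF2 i j hij h2
      · exact (hF1 i h1).2.trans (Finset.erase_subset _ _)
      · omega
      · exact subset_rfl
    · dsimp only
      by_cases hCE : C = E
      · rw [if_neg (by rw [hCE]; omega), hCE]
      · have hC' := Finset.mem_erase.2 ⟨hCE, hC⟩
        have h1 := Finset.card_le_card
          (Finset.subset_erase.2 ⟨hSE C hC, hx C hC'⟩)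
        rw [if_pos (by omega), hF3 C hC']

variable {k : Type*} [Field k] {n : ℕ}

theorem prod_sqfreeMonomial {ι : Type*} [DecidableEq ι] {M : ι → Finset (Fin n)}
    (hM : ∀ i j, i ≠ j → Disjoint (M i) (M j)) (s : Finset ι) :
    ∏ l ∈ s, sqfreeMonomial k (M l) = sqfreeMonomial k (s.biUnion M) := by
  rw [sqfreeMonomial, Finset.prod_biUnion fun i _ j _ hij => hM i j hij]
  rfl

/-- The generators of an ideal in nested form. -/
theorem sum_span_mul_span_eq {s : ℕ} {M Y : Fin s → Finset (Fin n)}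
    (hM : ∀ i j, i ≠ j → Disjoint (M i) (M j)) (hMY : ∀ i j, Disjoint (M i) (Y j)) :
    ∑ j : Fin s, Ideal.span {∏ l ∈ Finset.Iic j, sqfreeMonomial k (M l)} *
      Ideal.span ((fun i => (X i : MvPolynomial (Fin n) k)) '' (Y j : Set (Fin n))) =
    Ideal.span (sqfreeMonomial k ''
      ⋃ j, (fun y => insert y ((Finset.Iic j).biUnion M)) '' (Y j : Set (Fin n))) := by
  rw [Set.image_iUnion, Ideal.span_iUnion, ← Finset.sup_univ_eq_iSup, ← Ideal.sum_eq_sup]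
  refine Finset.sum_congr rfl fun j _ => ?_
  rw [Ideal.span_mul_span', Set.singleton_mul, Set.image_image, Set.image_image,
    prod_sqfreeMonomial hM]
  congr 1
  refine Set.image_congr fun y hy => ?_
  rw [sqfreeMonomial, sqfreeMonomial, Finset.prod_insert, mul_comm]
  intro h
  obtain ⟨l, _, hl⟩ := Finset.mem_biUnion.1 h
  exact Finset.disjoint_left.1 (hMY l j) hl hy

theorem HasNestedForm.exists_isNested {I : Ideal (MvPolynomial (Fin n) k)} (hI : HasNestedForm I) :
    ∃ G : Finset (Finset (Fin n)), IsNested G ∧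
      I = Ideal.span (sqfreeMonomial k '' (G : Set (Finset (Fin n)))) := by
  classical
  obtain ⟨s, M, Y, hY, hM, hYY, hMY, hI⟩ := hI
  rw [sum_span_mul_span_eq hM hMY] at hI
  set P : Fin s → Finset (Fin n) := fun j => (Finset.Iic j).biUnion M with hP
  have hPY : ∀ i j, ∀ y ∈ Y j, y ∉ P i := fun i j y hy h => by
    obtain ⟨l, _, hl⟩ := Finset.mem_biUnion.1 h
    exact Finset.disjoint_left.1 (hMY l j) hl hy
  have hPmono : ∀ i j, i ≤ j → P i ⊆ P j := fun i j hij =>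
    Finset.biUnion_subset_biUnion_of_subset_left _ (Finset.Iic_subset_Iic.2 hij)
  have hfin := Set.toFinite (⋃ j, (fun y => insert y (P j)) '' (Y j : Set (Fin n)))
  refine ⟨hfin.toFinset, ?_, by rw [Set.Finite.coe_toFinset, hI]⟩
  have hmem : ∀ g, g ∈ hfin.toFinset ↔ ∃ j, ∃ y ∈ Y j, insert y (P j) = g := by simp
  have hcore : ∀ g, ∃ C, g ∈ hfin.toFinset → ∃ j, ∃ y ∈ Y j, C = P j ∧ insert y (P j) = g :=
    fun g => by
      by_cases hg : g ∈ hfin.toFinset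
      · obtain ⟨j, y, hy, h⟩ := (hmem g).1 hg
        exact ⟨P j, fun _ => ⟨j, y, hy, rfl, h⟩⟩
      · exact ⟨∅, fun h => absurd h hg⟩
  choose C hC using hcore
  refine isNested_of_cores ?_ C (fun g hg => ?_) fun g hg h hh hc => ?_
  · intro g hg h hh hgh hsub
    obtain ⟨i, y, hy, rfl⟩ := (hmem g).1 hg
    obtain ⟨j, z, hz, rfl⟩ := (hmem h).1 hh
    have hyz : y = z := (Finset.mem_insert.1 (hsub (Finset.mem_insert_self y _))).resolve_right
      (hPY j i y hy)
    subst hyz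
    have hij : i = j := by
      by_contra h
      exact Finset.disjoint_left.1 (hYY i j h) hy hz
    exact hgh (by rw [hij])
  · obtain ⟨j, y, hy, h1, h2⟩ := hC g hg
    exact ⟨y, h1 ▸ hPY j j y hy, h1 ▸ h2⟩
  · obtain ⟨i, y, hy, h1, h2⟩ := hC g hg
    obtain ⟨j, z, hz, h3, h4⟩ := hC h hh
    rw [h1, h3]
    rcases le_total i j with hij | hij
    · exact hPmono i j hij
    · rw [← h2, ← h4, Finset.card_insert_of_notMem (hPY i i y hy),
        Finset.card_insert_of_notMem (hPY j j z hz)] at hc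
      exact (Finset.eq_of_subset_of_card_le (hPmono j i hij) (by omega)).ge

theorem IsNested.hasNestedForm {G : Finset (Finset (Fin n))} (hG : IsNested G) :
    HasNestedForm (Ideal.span (sqfreeMonomial k '' (G : Set (Finset (Fin n))))) := by
  classical
  rcases hG with rfl | ⟨y, hG⟩
  · refine ⟨0, fun _ => ∅, fun _ => ∅, fun j => j.elim0, fun j => j.elim0, fun j => j.elim0,
      fun j => j.elim0, ?_⟩
    simp
  -- the sets `g \ {y g}`, listed by their cardinalities
  set K := G.image fun g => (g.erase (y g)).card with hK
  set e := K.orderEmbOfFin rfl with he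
  have hP : ∀ j, ∃ g ∈ G, (g.erase (y g)).card = e j := fun j =>
    Finset.mem_image.1 (Finset.orderEmbOfFin_mem K rfl j)
  choose r hrG hr using hP
  set P : Fin K.card → Finset (Fin n) := fun j => (r j).erase (y (r j)) with hPdef
  have hcard : ∀ g ∈ G, (g.erase (y g)).card + 1 = g.card := fun g hg =>
    Finset.card_erase_add_one (hG.mem g hg)
  have hPmono : ∀ i j, i ≤ j → P i ⊆ P j := fun i j hij => by
    refine hG.mono _ (hrG i) _ (hrG j) ?_
    have h1 := hcard _ (hrG i)
    have h2 := hcard _ (hrG j)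
    have h3 := e.monotone hij
    rw [hr] at h1 h2
    omega
  have hPinj : ∀ i j, P i = P j → i = j := fun i j hij => by
    refine e.injective ?_
    rw [← hr i, ← hr j]
    exact congrArg _ hij
  have hGP : ∀ g ∈ G, ∃ j, g.erase (y g) = P j := fun g hg => by
    have h1 : (g.erase (y g)).card ∈ Set.range e := by
      rw [he, Finset.range_orderEmbOfFin]
      exact Finset.mem_coe.2 (Finset.mem_image_of_mem _ hg)
    obtain ⟨j, hj⟩ := h1
    refine ⟨j, Finset.eq_of_subset_of_card_le (hG.mono g hg _ (hrG j) ?_) ?_⟩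
    · rw [← hcard g hg, ← hcard _ (hrG j), hr, hj]
    · rw [hr, hj]
  set M : Fin K.card → Finset (Fin n) := fun j => P j \ (Finset.Iio j).biUnion P with hMdef
  set Y : Fin K.card → Finset (Fin n) := fun j =>
    (G.filter fun g => g.erase (y g) = P j).image y with hYdef
  have hMdisj : ∀ i j, i ≠ j → Disjoint (M i) (M j) := by
    intro i j hij
    wlog hlt : i < j generalizing i j
    · exact (this j i hij.symm (lt_of_le_of_ne (not_lt.1 hlt) hij.symm)).symm
    rw [Finset.disjoint_left]
    intro x hxi hxj
    exact (Finset.mem_sdiff.1 hxj).2 (Finset.mem_biUnion.2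
      ⟨i, Finset.mem_Iio.2 hlt, (Finset.mem_sdiff.1 hxi).1⟩)
  have hMY : ∀ i j, Disjoint (M i) (Y j) := by
    intro i j
    rw [Finset.disjoint_left]
    intro x hx hxY
    obtain ⟨g, hg, rfl⟩ := Finset.mem_image.1 hxY
    exact hG.notMem_erase (Finset.mem_filter.1 hg).1 (hrG i) (Finset.mem_sdiff.1 hx).1
  have hMP : ∀ j, (Finset.Iic j).biUnion M = P j := by
    intro j
    ext x
    constructor
    · intro hx
      obtain ⟨l, hl, hx⟩ := Finset.mem_biUnion.1 hx
      exact hPmono l j (Finset.mem_Iic.1 hl) (Finset.mem_sdiff.1 hx).1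
    · intro hx
      obtain ⟨l, hl, hmin⟩ := Finset.exists_min_image
        (Finset.univ.filter fun l => x ∈ P l) id ⟨j, by simpa using hx⟩
      simp only [Finset.mem_filter, Finset.mem_univ, true_and, id] at hl hmin
      refine Finset.mem_biUnion.2 ⟨l, Finset.mem_Iic.2 (hmin j hx), Finset.mem_sdiff.2 ⟨hl, ?_⟩⟩
      intro h
      obtain ⟨i, hi, hxi⟩ := Finset.mem_biUnion.1 h
      exact (Finset.mem_Iio.1 hi).not_ge (hmin i hxi)
  refine ⟨K.card, M, Y, fun j => ?_, hMdisj, fun i j hij => ?_, hMY, ?_⟩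
  · exact ⟨y (r j), Finset.mem_image_of_mem _ (Finset.mem_filter.2 ⟨hrG j, rfl⟩)⟩
  · rw [Finset.disjoint_left]
    intro x hx hx'
    obtain ⟨g, hg, rfl⟩ := Finset.mem_image.1 hx
    obtain ⟨h, hh, hyh⟩ := Finset.mem_image.1 hx'
    obtain ⟨hg, hgi⟩ := Finset.mem_filter.1 hg
    obtain ⟨hh, hhj⟩ := Finset.mem_filter.1 hh
    have := hG.injOn hh hg hyh
    subst this
    exact hij (hPinj i j (hgi.symm.trans hhj))
  · rw [sum_span_mul_span_eq hMdisj hMY]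
    congr 2
    ext g
    simp only [Set.mem_iUnion, Set.mem_image, Finset.mem_coe, hMP]
    constructor
    · intro hg
      obtain ⟨j, hj⟩ := hGP g hg
      refine ⟨j, y g, Finset.mem_image_of_mem _ (Finset.mem_filter.2 ⟨hg, hj⟩), ?_⟩
      rw [← hj, Finset.insert_erase (hG.mem g hg)]
    · rintro ⟨j, x, hx, rfl⟩
      obtain ⟨g, hg, rfl⟩ := Finset.mem_image.1 hx
      obtain ⟨hg, hgj⟩ := Finset.mem_filter.1 hg
      rwa [← hgj, Finset.insert_erase (hG.mem g hg)]

theorem card_sub_one_le_scDim {Δ : PreAbstractSimplicialComplex (Fin n)} {f : Finset (Fin n)}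
    (hf : f ∈ Δ.faces) : f.card - 1 ≤ scDim Δ :=
  le_csSup (Set.toFinite _).bddAbove ⟨f, hf, rfl⟩

theorem IsSupernova.exists_isNested {Δ : PreAbstractSimplicialComplex (Fin n)}
    (hΔ : IsSupernova Δ) : ∃ G : Finset (Finset (Fin n)), IsNested G ∧
      edgeIdeal k Δ = Ideal.span (sqfreeMonomial k '' (G : Set (Finset (Fin n)))) := by
  classical
  obtain ⟨F, hF, hFcard, hFf⟩ := hΔ
  have hfin := Set.toFinite (scFacets Δ)
  refine ⟨hfin.toFinset, ?_, by rw [Set.Finite.coe_toFinset, edgeIdeal]⟩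
  have hmem : ∀ {g}, g ∈ hfin.toFinset → g ∈ scFacets Δ := fun hg => hfin.mem_toFinset.1 hg
  have hpos : ∀ {g}, g ∈ hfin.toFinset → 0 < g.card := fun hg =>
    Finset.card_pos.2 (Δ.isRelLowerSet_faces (hmem hg).1).1
  have hdim : ∀ {g}, g ∈ hfin.toFinset → g.card - 1 ≤ scDim Δ := fun hg =>
    card_sub_one_le_scDim (hmem hg).1
  refine isNested_of_cores ?_
    (fun g => if h : 2 ≤ g.card ∧ g.card - 2 < scDim Δ then F ⟨g.card - 2, h.2⟩ else ∅)
    (fun g hg => ?_) fun g hg h hh hc => ?_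
  · intro g hg h hh hgh hsub
    exact hgh (Finset.Subset.antisymm hsub ((hmem hg).2 (hmem hh).1 hsub))
  · rw [Finset.exists_eq_insert_iff]
    have h1 := hpos hg
    have h2 := hdim hg
    split_ifs with h
    · refine ⟨hFf g (hmem hg) _ ?_, ?_⟩
      · dsimp only
        omega
      · rw [(hFcard _).2]
        dsimp only
        omega
    · refine ⟨Finset.empty_subset _, ?_⟩
      rw [Finset.card_empty]
      omega
  · have h2 := hdim hh
    split_ifs with h3 h4
    · exact hF.monotone (Fin.mk_le_mk.2 (by omega))
    · omega
    · exact Finset.empty_subset _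
    · exact subset_rfl

/-- The simplicial complex whose faces are the nonempty subsets of the members of `G`. -/
def complexOf (G : Finset (Finset (Fin n))) : PreAbstractSimplicialComplex (Fin n) where
  faces := {f | f.Nonempty ∧ ∃ g ∈ G, f ⊆ g}
  isRelLowerSet_faces := fun _ ⟨hf, g, hg, hfg⟩ =>
    ⟨hf, fun _ hb hbne => ⟨hbne, g, hg, hb.trans hfg⟩⟩

theorem scFacets_complexOf {G : Finset (Finset (Fin n))}
    (hanti : IsAntichain (· ⊆ ·) (G : Set (Finset (Fin n)))) (h0 : ∅ ∉ G) :
    scFacets (complexOf G) = (G : Set (Finset (Fin n))) := by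
  have hmem : ∀ g ∈ G, g ∈ (complexOf G).faces := fun g hg =>
    ⟨Finset.nonempty_iff_ne_empty.2 fun h => h0 (h ▸ hg), g, hg, subset_rfl⟩
  ext f
  constructor
  · rintro ⟨⟨_, g, hg, hfg⟩, hmax⟩
    exact (Finset.Subset.antisymm hfg (hmax (hmem g hg) hfg)) ▸ hg
  · intro hf
    refine ⟨hmem f hf, ?_⟩
    rintro f' ⟨_, g, hg, hfg⟩ hff'
    exact hanti.eq hf hg (hff'.trans hfg) ▸ hfg

theorem IsNested.exists_isSupernova {G : Finset (Finset (Fin n))} (hG : IsNested G) :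
    ∃ Δ : PreAbstractSimplicialComplex (Fin n), IsSupernova Δ ∧
      Ideal.span (sqfreeMonomial k '' (G : Set (Finset (Fin n)))) = edgeIdeal k Δ := by
  classical
  refine ⟨complexOf G, ?_, ?_⟩
  · rcases G.eq_empty_or_nonempty with rfl | hne
    · have hdim : scDim (complexOf (∅ : Finset (Finset (Fin n)))) = 0 := by
        simp [scDim, complexOf]
      have hemp : IsEmpty (Fin (scDim (complexOf (∅ : Finset (Finset (Fin n)))))) := by
        rw [hdim]
        infer_instance
      exact ⟨fun _ => ∅, fun i => hemp.elim i, fun i => hemp.elim i, fun _ _ i => hemp.elim i⟩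
    obtain ⟨y, hG⟩ := hG.resolve_left hne.ne_empty
    have h0 : ∅ ∉ G := fun h => by simpa using hG.mem _ h
    have hcard : ∀ g ∈ G, (g.erase (y g)).card + 1 = g.card := fun g hg =>
      Finset.card_erase_add_one (hG.mem g hg)
    obtain ⟨t, ht, hmax⟩ := Finset.exists_max_image G Finset.card hne
    have hdim : scDim (complexOf G) = (t.erase (y t)).card := by
      refine le_antisymm (csSup_le' ?_) ?_
      · rintro _ ⟨f, ⟨_, g, hg, hfg⟩, rfl⟩
        have h1 := Finset.card_le_card hfg
        have h2 := hmax g hg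
        have h3 := hcard t ht
        dsimp only
        omega
      · rw [Finset.card_erase_of_mem (hG.mem t ht)]
        exact card_sub_one_le_scDim (Δ := complexOf G) ⟨⟨_, hG.mem t ht⟩, t, ht, subset_rfl⟩
    obtain ⟨F, hF1, hF2, hF3⟩ := exists_flag (t.erase (y t)) (G.image fun g => g.erase (y g))
      (by
        simp only [Finset.mem_image, forall_exists_index, and_imp, forall_apply_eq_imp_iff₂]
        exact fun g hg => hG.mono g hg t ht (hmax g hg))
      (by
        simp only [Finset.mem_image, forall_exists_index, and_imp, forall_apply_eq_imp_iff₂]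
        intro g hg h hh hc
        have h1 := hcard g hg
        have h2 := hcard h hh
        exact hG.mono g hg h hh (by omega))
    rw [← hdim] at hF1 hF2
    refine ⟨fun i => F (i + 1), fun i j hij => ?_, fun i => ⟨⟨?_, t, ht, ?_⟩, ?_⟩,
      fun f hf i hi => ?_⟩
    · refine Finset.ssubset_iff_subset_ne.2 ⟨hF2 _ _ (Nat.succ_le_succ (le_of_lt hij)) j.2,
        fun h => ?_⟩
      have h1 := (hF1 (i + 1) i.2).1
      have h2 := (hF1 (j + 1) j.2).1
      rw [show F (i + 1) = F (j + 1) from h, h2] at h1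
      have : (i : ℕ) < j := hij
      omega
    · rw [← Finset.card_pos, (hF1 (i + 1) i.2).1]
      exact Nat.succ_pos _
    · exact (hF1 (i + 1) i.2).2.trans (Finset.erase_subset _ _)
    · exact (hF1 (i + 1) i.2).1
    · rw [scFacets_complexOf hG.antichain h0] at hf
      have h1 := hF3 (f.erase (y f)) (Finset.mem_image_of_mem _ hf)
      have h2 := hcard f hf
      rw [show (f.erase (y f)).card = i + 1 by omega] at h1
      dsimp only
      rw [h1]
      exact Finset.erase_subset _ _
  · have h : IsAntichain (· ⊆ ·) (G : Set (Finset (Fin n))) ∧ ∅ ∉ G := by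
      rcases hG with rfl | ⟨y, hG⟩
      · simp
      · exact ⟨hG.antichain, fun h => by simpa using hG.mem _ h⟩
    rw [edgeIdeal, scFacets_complexOf h.1 h.2]

end NestedForms

theorem IsNested.card_le {n : ℕ} {G : Finset (Finset (Fin n))} (hG : IsNested G) : G.card ≤ n := by
  rcases hG with rfl | ⟨y, hG⟩
  · simp
  · simpa using Finset.card_le_card_of_injOn y (fun _ _ => Finset.mem_univ _) hG.injOn

theorem theorem3 {k : Type*} [Field k] {n : ℕ} (I : Ideal (MvPolynomial (Fin n) k))
    (hI : IsSquarefreeMonomialIdeal I) (hI_ne : I ≠ ⊤) :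
    (IsGotzmannIdeal I ↔ HasNestedForm I) ∧
    (IsGotzmannIdeal I ↔
      ∃ Δ : PreAbstractSimplicialComplex (Fin n), IsSupernova Δ ∧ I = edgeIdeal k Δ) ∧
    (IsGotzmannIdeal I → (monomialGens I).encard ≤ n) := by
  obtain ⟨G, hanti, h0, hIG, hgens⟩ := hI.exists_family hI_ne
  have hnested : IsGotzmannIdeal I → IsNested G := fun h => by
    rw [hIG, isGotzmannIdeal_span_sqfreeMonomial_iff] at h
    exact h.isNested hanti h0 fun g _ => Finset.subset_univ g
  have hgotz : ∀ {G' : Finset (Finset (Fin n))}, IsNested G' →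
      I = Ideal.span (sqfreeMonomial k '' (G' : Set (Finset (Fin n)))) → IsGotzmannIdeal I :=
    fun hG' h => by
      rw [h, isGotzmannIdeal_span_sqfreeMonomial_iff]
      exact hG'.isGotzmannFamily fun g _ => Finset.subset_univ g
  refine ⟨⟨fun h => ?_, fun h => ?_⟩, ⟨fun h => ?_, ?_⟩, fun h => ?_⟩
  · rw [hIG]
    exact (hnested h).hasNestedForm
  · obtain ⟨G', hG', h⟩ := h.exists_isNested
    exact hgotz hG' h
  · rw [hIG]
    exact (hnested h).exists_isSupernova
  · rintro ⟨Δ, hΔ, rfl⟩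
    obtain ⟨G', hG', h⟩ := hΔ.exists_isNested (k := k)
    exact hgotz hG' h
  · rw [hgens]
    refine (Set.encard_image_le _ _).trans ?_
    rw [Set.encard_coe_eq_coe_finsetCard]
    exact_mod_cast (hnested h).card_le
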